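/- **Setting.** Let $\theta\in(0,\pi/4)$, $\mathcal R=[0,1]^2$, $Z=(\tfrac12,\tfrac12)$, and let $E_1=(0,0)$, $E_2=(1,0)$, $E_3=(1,1)$, $E_4=(0,1)$; indices are in $\{1,2,3,4\}$, cyclically. Let $L_i$ be the ray from $E_i$ into $\mathcal R$ making the angle $\theta$ with the side $\overline{E_iE_{i+1}}$, let $P_i=L_{i-1}\cap L_i$ (so $P_1=(s,t)$ with $s=\sin\theta\cos\theta$, $t=\sin^2\theta$), and let $P'_1=(1-s,t)$ and $P'_2,P'_3,P'_4$ be its successive images under the counterclockwise rotation $R$ by $\pi/2$ about $Z$. Then $\mathcal R$ is divided into the closed triangles $\mathcal A_i=\Delta(E_i,E_{i+1},P_i)$ and $\mathcal B_i=\Delta(E_i,P_i,P_{i-1})$ and the closed centre square $\mathcal C$ with vertices $P_1,\dots,P_4$. Let $F=F_\theta:\mathcal R\to\mathcal R$ be the homeomorphism that is affine on each of these nine pieces and satisfies $F(E_i)=E_i$, $F(P_i)=P'_i$. An *invariant circle* is a simple closed curve $\Gamma\subset\mathcal R$ encircling $Z$ (winding number $\pm1$ about $Z$) with $F(\Gamma)=\Gamma$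 on which $F$ preserves the cyclic order of points; $\rho_\Gamma\in\mathbb R/\mathbb Z$ denotes the rotation number of $F|_\Gamma$, with $\Gamma$ oriented counterclockwise. It is *rotationally symmetric* if $R(\Gamma)=\Gamma$. Let $\Gamma$ be a rotationally symmetric invariant circle disjoint from $\mathcal C$ with rational rotation number $\rho_\Gamma=p/q$ mod $1$ ($p,q\in\mathbb Z$, $q>0$). For each $i$, let $U_i$ and $V_i$ denote the points in which $\Gamma$ meets the break segments $\mathcal B_i\cap\mathcal A_i=\overline{E_iP_i}$ and $\mathcal A_i\cap\mathcal B_{i+1}=\overline{E_{i+1}P_i}$, that is, $\Gamma\cap\mathcal B_i\cap\mathcal A_i=\{U_i\}$ and $\Gamma\cap\mathcal A_i\cap\mathcal B_{i+1}=\{V_i\}$. Write $\mathrm{orb}(X)=\{F^n(X):n\in\mathbb Z\}$. **Proposition 4.4.** For every $i$ the orbit $\mathrm{orb}(U_i)$ contains some $V_j$, and for every $j$ the orbit $\mathrm{orb}(V_j)$ contains some $U_i$. Moreover, let $X$ be one of the points $U_i,V_i$. Then there is an $n$ such that $\mathrm{orb}(X)$ contains exactly $n$ of the $U_i$ and exactly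 $n$ of the $V_j$, and these are traversed in alternating order: if $a<b$ are integers such that $F^a(X)$ and $F^b(X)$ are both among the $U_i$, then $F^k(X)$ is one of the $V_j$ for some $a\le k<b$, and the same holds with the roles of the $U_i$ and the $V_j$ exchanged. (The case $k=a$ matters only if some $U_i$ equals some $V_j$, as on $\Gamma=\partial\mathcal R$, where $U_i=V_{i-1}=E_i$.) If $n\ge2$, then $\mathrm{orb}(X)$ is periodic, i.e. $F^k(X)=X$ for some $k\ge1$. -/

import Mathlib

open Set

namespace NinePiece

/-- The plane with Cartesian coordinates; the unit square is `[0,1] × [0,1]`. -/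
abbrev Plane : Type := ℝ × ℝ

/-- The unit square. -/
def square : Set Plane := Icc 0 1 ×ˢ Icc 0 1

/-- The centre of the unit square. -/
noncomputable def Z : Plane := (1 / 2, 1 / 2)

/-- The counterclockwise rotation about `Z` by the angle `π/2`. -/
def rot (z : Plane) : Plane := (1 - z.2, z.1)

/-- The clockwise rotation about `Z` by the angle `π/2`. -/
def rotInv (z : Plane) : Plane := (z.2, 1 - z.1)

/-- The vertices `(0,0), (1,0), (1,1), (0,1)` of the unit square. All indices are in `Fin 4`, whose
addition and subtraction are cyclic; the index `i : Fin 4` stands for the index `i + 1` of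
`{1,2,3,4}`. -/
def E (i : Fin 4) : Plane := rot^[(i : ℕ)] (0, 0)

/-- The abscissa `s` of the first vertex of the inner square. -/
noncomputable def sCoord (θ : ℝ) : ℝ := Real.sin θ * Real.cos θ

/-- The ordinate `t` of the first vertex of the inner square. -/
noncomputable def tCoord (θ : ℝ) : ℝ := Real.sin θ ^ 2

/-- The ray `L i` through `E i`, making the angle `θ` with the side from `E i` to `E (i + 1)`. -/
def ray (θ : ℝ) (i : Fin 4) : Set Plane :=
  {z | ∃ r : ℝ, 0 ≤ r ∧ z = rot^[(i : ℕ)] (r * Real.cos θ, r * Real.sin θ)}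

/-- The vertices of the inner square: `P θ i` is the intersection of the rays `L (i - 1)` and `L i`,
see `ray_inter_ray`. -/
noncomputable def P (θ : ℝ) (i : Fin 4) : Plane := rot^[(i : ℕ)] (sCoord θ, tCoord θ)

/-- The vertices of the inner square of the reversed construction, in counterclockwise order; the
first one has the same ordinate as `P θ 0`. -/
noncomputable def P' (θ : ℝ) (i : Fin 4) : Plane := rot^[(i : ℕ)] (1 - sCoord θ, tCoord θ)

/-- The closed triangle with vertices `E i, E (i + 1), P i`. -/
def pieceA (θ : ℝ) (i : Fin 4) : Set Plane := convexHull ℝ {E i, E (i + 1), P θ i}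

/-- The closed triangle with vertices `E i, P i, P (i - 1)`. -/
def pieceB (θ : ℝ) (i : Fin 4) : Set Plane := convexHull ℝ {E i, P θ i, P θ (i - 1)}

/-- The closed centre square with vertices `P i`. -/
def pieceC (θ : ℝ) : Set Plane := convexHull ℝ {P θ 0, P θ 1, P θ 2, P θ 3}

/-- The shear by which the map acts on `pieceA θ 0`. -/
noncomputable def mapA (θ : ℝ) (z : Plane) : Plane :=
  (z.1 + (1 - 2 * sCoord θ) / tCoord θ * z.2, z.2)

/-- The linear map by which the map acts on `pieceB θ 0`. -/
noncomputable def mapB (θ : ℝ) (z : Plane) : Plane :=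
  (((tCoord θ ^ 2 - (1 - sCoord θ) ^ 2) * z.1 + (1 - 2 * sCoord θ) * tCoord θ * z.2)
      / (tCoord θ - sCoord θ),
    ((2 * sCoord θ - 1) * tCoord θ * z.1 + (2 * tCoord θ - 1) * tCoord θ * z.2)
      / (tCoord θ - sCoord θ))

/-- The rotation about `Z` by which the map acts on the centre square. -/
noncomputable def mapC (θ : ℝ) (z : Plane) : Plane :=
  (2 * sCoord θ * z.1 + (2 * tCoord θ - 1) * z.2 + (1 - tCoord θ - sCoord θ),
    (1 - 2 * tCoord θ) * z.1 + 2 * sCoord θ * z.2 + (tCoord θ - sCoord θ))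

/-- The conjugate of `g` by the `i`-th power of the rotation by `π/2`. -/
def conjRot (i : Fin 4) (g : Plane → Plane) (z : Plane) : Plane :=
  rot^[(i : ℕ)] (g (rotInv^[(i : ℕ)] z))

open Classical in
/-- The piecewise affine map `F_θ`, extended by the identity outside the unit square (it is the
identity on the boundary of the square). The choice of the piece does not matter on overlaps, and
the map is the one determined by `E i ↦ E i`, `P i ↦ P' i` and being affine on every piece: see
`F_E`, `F_P`, `F_of_mem_A`, `F_of_mem_B`, `F_of_mem_C` below. -/
noncomputable def F (θ : ℝ) (z : Plane) : Plane :=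
  if z ∈ pieceC θ then mapC θ z
  else if h : ∃ i, z ∈ pieceA θ i then conjRot h.choose (mapA θ) z
  else if h : ∃ i, z ∈ pieceB θ i then conjRot h.choose (mapB θ) z
  else z

/-! Elementary facts: the map is well defined on overlaps, the pieces tile the square, and the map
is bijective, with inverse its conjugate by the reflection `(x, y) ↦ (1 - x, y)`. -/

/-- The reflection in the vertical line through `Z`. -/
def mirror (z : Plane) : Plane := (1 - z.1, z.2)

lemma coords {θ : ℝ} (hθ : θ ∈ Ioo 0 (Real.pi / 4)) :
    0 < tCoord θ ∧ tCoord θ < sCoord θ ∧ 2 * sCoord θ < 1 ∧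
      sCoord θ ^ 2 = tCoord θ - tCoord θ ^ 2 := by
  obtain ⟨h0, h1⟩ := hθ
  have hpi := Real.pi_pos
  have hs : 0 < Real.sin θ := Real.sin_pos_of_pos_of_lt_pi h0 (by linarith)
  have hc : 0 < Real.cos (2 * θ) := Real.cos_pos_of_mem_Ioo ⟨by linarith, by linarith⟩
  have hcc : 0 < Real.cos θ := Real.cos_pos_of_mem_Ioo ⟨by linarith, by linarith⟩
  have h2 := Real.sin_sq_add_cos_sq θ
  rw [Real.cos_two_mul] at hc
  have hlt : Real.sin θ < Real.cos θ := by nlinarith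
  refine ⟨by unfold tCoord; positivity, ?_, ?_, ?_⟩
  · unfold tCoord sCoord; nlinarith
  · unfold sCoord; nlinarith [mul_pos (sub_pos.2 hlt) (sub_pos.2 hlt)]
  · unfold tCoord sCoord
    have : Real.cos θ ^ 2 = 1 - Real.sin θ ^ 2 := by linarith
    rw [mul_pow, this]; ring

@[simp] lemma rotInv_rot (z : Plane) : rotInv (rot z) = z := by simp [rot, rotInv]
@[simp] lemma rot_rotInv (z : Plane) : rot (rotInv z) = z := by simp [rot, rotInv]
@[simp] lemma refl_refl (z : Plane) : mirror (mirror z) = z := by simp [mirror]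

lemma ray_inter_ray {θ : ℝ} (hθ : θ ∈ Ioo 0 (Real.pi / 4)) (i : Fin 4) :
    ray θ (i - 1) ∩ ray θ i = {P θ i} := by
  obtain ⟨h0, h1⟩ := hθ
  have hpi := Real.pi_pos
  have hs : 0 < Real.sin θ := Real.sin_pos_of_pos_of_lt_pi h0 (by linarith)
  have hc : 0 < Real.cos θ := Real.cos_pos_of_mem_Ioo ⟨by linarith, by linarith⟩
  have h2 := Real.sin_sq_add_cos_sq θ
  have key : ∀ r u : ℝ, u * Real.sin θ = r * Real.cos θ → 1 - u * Real.cos θ = r * Real.sin θ →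
      r = Real.sin θ ∧ u = Real.cos θ := by
    intro r u e1 e2
    have hu : u = Real.cos θ := by linear_combination Real.sin θ * e1 - Real.cos θ * e2 - u * h2
    have hr : r = Real.sin θ := by linear_combination -Real.cos θ * e1 - Real.sin θ * e2 - r * h2
    exact ⟨hr, hu⟩
  ext z
  simp only [mem_inter_iff, ray, mem_ofPred_eq, mem_singleton_iff]
  constructor
  · rintro ⟨⟨u, hu, rfl⟩, r, hr, h⟩
    have : r = Real.sin θ ∧ u = Real.cos θ := by
      fin_cases i <;> simp [rot, Prod.ext_iff] at h <;>
        exact key r u (by linarith [h.1, h.2]) (by linarith [h.1, h.2])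
    rw [h, this.1]
    fin_cases i <;> simp [P, rot, sCoord, tCoord, sq]
  · rintro rfl
    refine ⟨⟨Real.cos θ, hc.le, ?_⟩, Real.sin θ, hs.le, ?_⟩
    · fin_cases i <;> simp [P, rot, sCoord, tCoord, Prod.ext_iff] <;>
        (try constructor) <;> nlinarith
    · fin_cases i <;> simp [P, rot, sCoord, tCoord, sq]

lemma rotInv_iter_rot_iter (n : ℕ) (z : Plane) : rotInv^[n] (rot^[n] z) = z :=
  Function.LeftInverse.iterate rotInv_rot n z

lemma rot_iter_rotInv_iter (n : ℕ) (z : Plane) : rot^[n] (rotInv^[n] z) = z :=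
  Function.LeftInverse.iterate rot_rotInv n z

/-- A self-map of the plane that respects convex combinations. -/
def RespectsCombos (g : Plane → Plane) : Prop :=
  ∀ x y : Plane, ∀ a b : ℝ, a + b = 1 → g (a • x + b • y) = a • g x + b • g y

lemma respects_mapA (θ : ℝ) : RespectsCombos (mapA θ) := by
  intro x y a b h
  ext <;> simp [mapA] <;> ring

lemma respects_mapB (θ : ℝ) : RespectsCombos (mapB θ) := by
  intro x y a b h
  ext <;> simp [mapB] <;> ring

lemma respects_mapC (θ : ℝ) : RespectsCombos (mapC θ) := by
  intro x y a b h
  obtain rfl : b = 1 - a := by linarith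
  ext <;> simp [mapC] <;> ring

lemma respects_rot : RespectsCombos rot := by
  intro x y a b h
  obtain rfl : b = 1 - a := by linarith
  ext <;> simp [rot]; ring

lemma respects_rotInv : RespectsCombos rotInv := by
  intro x y a b h
  obtain rfl : b = 1 - a := by linarith
  ext <;> simp [rotInv]; ring

lemma respects_refl : RespectsCombos mirror := by
  intro x y a b h
  obtain rfl : b = 1 - a := by linarith
  ext <;> simp [mirror]; ring

lemma RespectsCombos.comp {f g : Plane → Plane} (hf : RespectsCombos f) (hg : RespectsCombos g) :
    RespectsCombos (f ∘ g) := by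
  intro x y a b h
  simp only [Function.comp_apply]
  rw [hg x y a b h, hf _ _ a b h]

lemma RespectsCombos.iterate {f : Plane → Plane} (hf : RespectsCombos f) (n : ℕ) :
    RespectsCombos f^[n] := by
  induction n with
  | zero => intro x y a b _; rfl
  | succ n ih => rw [Function.iterate_succ]; exact ih.comp hf

lemma respects_conjRot (i : Fin 4) {g : Plane → Plane} (hg : RespectsCombos g) :
    RespectsCombos (conjRot i g) :=
  ((respects_rot.iterate i).comp hg).comp (respects_rotInv.iterate i)

lemma RespectsCombos.mem {g : Plane → Plane} (hg : RespectsCombos g) {S T : Set Plane}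
    (h : ∀ z ∈ S, g z ∈ convexHull ℝ T) {z : Plane} (hz : z ∈ convexHull ℝ S) :
    g z ∈ convexHull ℝ T := by
  have hc : Convex ℝ (g ⁻¹' convexHull ℝ T) := by
    intro x hx y hy a b ha hb hab
    rw [mem_preimage, hg x y a b hab]
    exact convex_convexHull ℝ T hx hy ha hb hab
  exact convexHull_min (fun z hz => h z hz) hc hz

lemma combo_mem {S : Set Plane} {p q r u : Plane} (hp : p ∈ S) (hq : q ∈ S) (hr : r ∈ S)
    (hu : u ∈ S) {a b c d : ℝ} (ha : 0 ≤ a) (hb : 0 ≤ b) (hc : 0 ≤ c) (hd : 0 ≤ d)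
    (h : a + b + c + d = 1) : a • p + b • q + c • r + d • u ∈ convexHull ℝ S := by
  have := (convex_convexHull ℝ S).sum_mem (t := Finset.univ) (w := ![a, b, c, d])
    (z := ![p, q, r, u])
    (by intro i _; fin_cases i <;> simpa)
    (by simp [Fin.sum_univ_four, h])
    (by intro i _; fin_cases i <;> simp <;> exact subset_convexHull ℝ S (by assumption))
  simpa [Fin.sum_univ_four] using this

lemma half_plane {S : Set Plane} {α β γ : ℝ} (h : ∀ z ∈ S, 0 ≤ α * z.1 + β * z.2 + γ) {z : Plane}
    (hz : z ∈ convexHull ℝ S) : 0 ≤ α * z.1 + β * z.2 + γ := by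
  have hc : Convex ℝ {z : Plane | 0 ≤ α * z.1 + β * z.2 + γ} := by
    intro x hx y hy a b ha hb hab
    simp only [mem_ofPred_eq] at hx hy ⊢
    have e : α * (a • x + b • y).1 + β * (a • x + b • y).2 + γ
        = a * (α * x.1 + β * x.2 + γ) + b * (α * y.1 + β * y.2 + γ) := by
      obtain rfl : b = 1 - a := by linarith
      simp; ring
    rw [e]; positivity
  exact convexHull_min (fun z hz => h z hz) hc hz

lemma mem_A_zero {θ : ℝ} (hθ : θ ∈ Ioo 0 (Real.pi / 4)) (z : Plane) : z ∈ pieceA θ 0 ↔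
    0 ≤ z.2 ∧ 0 ≤ tCoord θ * z.1 - sCoord θ * z.2 ∧
      0 ≤ tCoord θ * (1 - z.1) - (1 - sCoord θ) * z.2 := by
  obtain ⟨h1, h2, h3, h4⟩ := coords hθ
  simp only [pieceA, E, P, Fin.isValue, Fin.val_zero, Function.iterate_zero, id, zero_add,
    Fin.val_one, Function.iterate_one, rot, sub_zero]
  generalize sCoord θ = s at *
  generalize tCoord θ = t at *
  constructor
  · intro hz
    refine ⟨?_, ?_, ?_⟩
    · have := half_plane (α := 0) (β := 1) (γ := 0) (by
        rintro w (rfl | rfl | rfl) <;> simp; linarith) hz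
      linarith
    · have := half_plane (α := t) (β := -s) (γ := 0) (by
        rintro w (rfl | rfl | rfl) <;> simp <;> nlinarith) hz
      linarith
    · have := half_plane (α := -t) (β := -(1 - s)) (γ := t) (by
        rintro w (rfl | rfl | rfl) <;> simp <;> nlinarith) hz
      linarith
  · rintro ⟨e1, e2, e3⟩
    have := combo_mem (S := {((0 : ℝ), (0 : ℝ)), (1, 0), (s, t)}) (p := (0, 0)) (q := (1, 0))
      (r := (s, t)) (u := (0, 0)) (by simp) (by simp) (by simp) (by simp)
      (a := (t * (1 - z.1) - (1 - s) * z.2) / t) (b := (t * z.1 - s * z.2) / t) (c := z.2 / t)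
      (d := 0) (by positivity) (by positivity) (by positivity) le_rfl (by field_simp; ring)
    convert this using 1
    ext <;> simp <;> field_simp; ring

lemma mem_B_zero {θ : ℝ} (hθ : θ ∈ Ioo 0 (Real.pi / 4)) (z : Plane) : z ∈ pieceB θ 0 ↔
    tCoord θ * z.1 - sCoord θ * z.2 ≤ 0 ∧ 0 ≤ (1 - sCoord θ) * z.1 - tCoord θ * z.2 ∧
      0 ≤ tCoord θ * (1 - z.2) - sCoord θ * z.1 := by
  obtain ⟨h1, h2, h3, h4⟩ := coords hθ
  have h30 : (0 - 1 : Fin 4) = 3 := rfl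
  have h33 : ((3 : Fin 4) : ℕ) = 3 := rfl
  simp only [pieceB, E, P, Fin.isValue, Fin.val_zero, Function.iterate_zero, id, h30, h33,
    Function.iterate_succ, Function.comp_apply, rot]
  generalize sCoord θ = s at *
  generalize tCoord θ = t at *
  constructor
  · intro hz
    refine ⟨?_, ?_, ?_⟩
    · have := half_plane (α := -t) (β := s) (γ := 0) (by
        rintro w (rfl | rfl | rfl) <;> simp <;> nlinarith) hz
      linarith
    · have := half_plane (α := 1 - s) (β := -t) (γ := 0) (by
        rintro w (rfl | rfl | rfl) <;> simp <;> nlinarith) hz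
      linarith
    · have := half_plane (α := -s) (β := -t) (γ := t) (by
        rintro w (rfl | rfl | rfl) <;> simp <;> nlinarith) hz
      linarith
  · rintro ⟨e1, e2, e3⟩
    have hst : 0 < s - t := by linarith
    have e1' : 0 ≤ s * z.2 - t * z.1 := by linarith
    have := combo_mem (S := {((0 : ℝ), (0 : ℝ)), (s, t), (1 - (1 - t), 1 - s)}) (p := (0, 0))
      (q := (s, t)) (r := (1 - (1 - t), 1 - s)) (u := (0, 0))
      (by simp) (by simp) (by simp) (by simp)
      (a := (t * (1 - z.2) - s * z.1) / t) (b := ((1 - s) * z.1 - t * z.2) / (s - t))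
      (c := (s * z.2 - t * z.1) / (s - t))
      (d := 0) (by positivity) (by positivity) (by positivity) le_rfl
      (by field_simp; linear_combination -z.1 * h4)
    convert this using 1
    ext
    · simp; field_simp; linear_combination z.1 * h4
    · simp; field_simp; linear_combination z.2 * h4

lemma mem_C {θ : ℝ} (hθ : θ ∈ Ioo 0 (Real.pi / 4)) (z : Plane) : z ∈ pieceC θ ↔
    tCoord θ * z.1 - sCoord θ * z.2 ≤ 0 ∧ tCoord θ * z.2 - sCoord θ * (1 - z.1) ≤ 0 ∧
      tCoord θ * (1 - z.1) - sCoord θ * (1 - z.2) ≤ 0 ∧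
      tCoord θ * (1 - z.2) - sCoord θ * z.1 ≤ 0 := by
  obtain ⟨h1, h2, h3, h4⟩ := coords hθ
  have h33 : ((3 : Fin 4) : ℕ) = 3 := rfl
  have h22 : ((2 : Fin 4) : ℕ) = 2 := rfl
  simp only [pieceC, P, Fin.isValue, Fin.val_zero, Function.iterate_zero, id, h22, h33,
    Fin.val_one, Function.iterate_succ, Function.comp_apply, rot]
  generalize sCoord θ = s at *
  generalize tCoord θ = t at *
  constructor
  · intro hz
    refine ⟨?_, ?_, ?_, ?_⟩
    · have := half_plane (α := -t) (β := s) (γ := 0) (by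
        rintro w (rfl | rfl | rfl | rfl) <;> simp <;> nlinarith) hz
      linarith
    · have := half_plane (α := -s) (β := -t) (γ := s) (by
        rintro w (rfl | rfl | rfl | rfl) <;> simp <;> nlinarith) hz
      linarith
    · have := half_plane (α := t) (β := -s) (γ := s - t) (by
        rintro w (rfl | rfl | rfl | rfl) <;> simp <;> nlinarith) hz
      linarith
    · have := half_plane (α := s) (β := t) (γ := -t) (by
        rintro w (rfl | rfl | rfl | rfl) <;> simp <;> nlinarith) hz
      linarith
  · rintro ⟨e1, e2, e3, e4⟩
    have hst : 0 < s - t := by linarith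
    have f1 : 0 ≤ (s * z.2 - t * z.1) / (s - t) := div_nonneg (by linarith) hst.le
    have f2 : 0 ≤ (s * z.1 - t * (1 - z.2)) / (s - t) := div_nonneg (by linarith) hst.le
    have f3 : 0 ≤ (s * (1 - z.2) - t * (1 - z.1)) / (s - t) := div_nonneg (by linarith) hst.le
    have f4 : 0 ≤ (s * (1 - z.1) - t * z.2) / (s - t) := div_nonneg (by linarith) hst.le
    have s1 : (s * z.2 - t * z.1) / (s - t) + (s * (1 - z.2) - t * (1 - z.1)) / (s - t) = 1 := by
      field_simp; ring
    have s2 : (s * z.1 - t * (1 - z.2)) / (s - t) + (s * (1 - z.1) - t * z.2) / (s - t) = 1 := by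
      field_simp; ring
    have g1 : (s * z.2 - t * z.1) = (s * z.2 - t * z.1) / (s - t) * (s - t) := by field_simp
    have g2 : (s * z.1 - t * (1 - z.2)) = (s * z.1 - t * (1 - z.2)) / (s - t) * (s - t) := by
      field_simp
    generalize (s * z.2 - t * z.1) / (s - t) = b at *
    generalize (s * z.1 - t * (1 - z.2)) / (s - t) = a at *
    generalize (s * (1 - z.2) - t * (1 - z.1)) / (s - t) = b' at *
    generalize (s * (1 - z.1) - t * z.2) / (s - t) = a' at *
    have := combo_mem (S := {(s, t), (1 - t, s), (1 - s, 1 - t), (1 - (1 - t), 1 - s)})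
      (p := (s, t)) (q := (1 - t, s)) (r := (1 - s, 1 - t)) (u := (1 - (1 - t), 1 - s))
      (by simp) (by simp) (by simp) (by simp)
      (a := a' * b') (b := a * b') (c := a * b) (d := a' * b)
      (by positivity) (by positivity) (by positivity) (by positivity)
      (by linear_combination (a + a') * s1 + s2)
    obtain rfl : b' = 1 - b := by linarith
    obtain rfl : a' = 1 - a := by linarith
    convert this using 1
    ext
    · simp
      have ht : t ≠ 0 := h1.ne'
      apply mul_left_cancel₀ ht
      linear_combination s * g2 - t * g1 - z.1 * h4 + a * h4
    · simp
      have ht : t ≠ 0 := h1.ne'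
      apply mul_left_cancel₀ ht
      linear_combination s * g1 + t * g2 - z.2 * h4 + b * h4
lemma mem_shift {X : Fin 4 → Set Plane} {S : Fin 4 → Set Plane}
    (hX : ∀ i, X i = convexHull ℝ (S i)) (h1 : ∀ i, ∀ z ∈ S i, rot z ∈ convexHull ℝ (S (i + 1)))
    (h2 : ∀ i, ∀ z ∈ S (i + 1), rotInv z ∈ convexHull ℝ (S i)) (i : Fin 4) (z : Plane) :
    z ∈ X i ↔ rotInv^[(i : ℕ)] z ∈ X 0 := by
  have key : ∀ i z, z ∈ X (i + 1) ↔ rotInv z ∈ X i := by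
    intro i z
    rw [hX, hX]
    refine ⟨fun h => respects_rotInv.mem (h2 i) h, fun h => ?_⟩
    have := respects_rot.mem (h1 i) h
    rwa [rot_rotInv] at this
  have k0 := key 0
  have k1 := key 1
  have k2 := key 2
  simp only [Fin.isValue, zero_add, Fin.reduceAdd] at k0 k1 k2
  fin_cases i
  · simp
  · simp [k0]
  · simp [k0, k1]
  · simp [k0, k1, k2]

lemma rot_E (i : Fin 4) : rot (E i) = E (i + 1) := by
  fin_cases i <;> simp [rot, E]

lemma rot_P (θ : ℝ) (i : Fin 4) : rot (P θ i) = P θ (i + 1) := by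
  fin_cases i <;> simp [rot, P]

lemma rotInv_E (i : Fin 4) : rotInv (E (i + 1)) = E i := by rw [← rot_E, rotInv_rot]

lemma rotInv_P (θ : ℝ) (i : Fin 4) : rotInv (P θ (i + 1)) = P θ i := by rw [← rot_P, rotInv_rot]

lemma mem_A_iff (θ : ℝ) (i : Fin 4) (z : Plane) :
    z ∈ pieceA θ i ↔ rotInv^[(i : ℕ)] z ∈ pieceA θ 0 := by
  refine mem_shift (S := fun i => {E i, E (i + 1), P θ i}) (X := pieceA θ) (fun _ => rfl) ?_ ?_ i z
  · rintro i z (rfl | rfl | rfl) <;> apply subset_convexHull <;> simp [rot_E, rot_P]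
  · rintro i z (rfl | rfl | rfl) <;> apply subset_convexHull <;> simp [rotInv_E, rotInv_P]

lemma mem_B_iff (θ : ℝ) (i : Fin 4) (z : Plane) :
    z ∈ pieceB θ i ↔ rotInv^[(i : ℕ)] z ∈ pieceB θ 0 := by
  have e : ∀ i : Fin 4, i + 1 - 1 = i - 1 + 1 := by decide
  refine mem_shift (S := fun i => {E i, P θ i, P θ (i - 1)}) (X := pieceB θ) (fun _ => rfl) ?_ ?_ i z
  · rintro i z (rfl | rfl | rfl) <;> apply subset_convexHull <;> simp [rot_E, rot_P]
  · rintro i z (rfl | rfl | rfl) <;> apply subset_convexHull <;>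
      simp only [e, rotInv_E, rotInv_P] <;> simp

lemma rot_mem_C {θ : ℝ} (hθ : θ ∈ Ioo 0 (Real.pi / 4)) (z : Plane) :
    rotInv z ∈ pieceC θ ↔ z ∈ pieceC θ := by
  rw [mem_C hθ, mem_C hθ]
  simp only [rotInv, sub_sub_cancel]
  tauto

lemma rotInv_iter_mem_C {θ : ℝ} (hθ : θ ∈ Ioo 0 (Real.pi / 4)) (n : ℕ) (z : Plane) :
    rotInv^[n] z ∈ pieceC θ ↔ z ∈ pieceC θ := by
  induction n with
  | zero => simp
  | succ n ih => rw [Function.iterate_succ_apply', rot_mem_C hθ, ih]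

lemma mapC_rot (θ : ℝ) (z : Plane) : mapC θ (rot z) = rot (mapC θ z) := by
  ext <;> simp [mapC, rot] <;> ring

lemma conjRot_mapC (θ : ℝ) (i : Fin 4) (z : Plane) : conjRot i (mapC θ) z = mapC θ z := by
  have : Function.Commute rot (mapC θ) := fun z => (mapC_rot θ z).symm
  rw [conjRot, (this.iterate_left i).eq, rot_iter_rotInv_iter]

lemma conjRot_add (i k : Fin 4) (g : Plane → Plane) (z : Plane) :
    conjRot (i + k) g z = rot^[(i : ℕ)] (conjRot k g (rotInv^[(i : ℕ)] z)) := by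
  fin_cases i <;> fin_cases k <;> simp [conjRot, rot, rotInv]

lemma rotInv_iter_add (i k : Fin 4) (z : Plane) :
    rotInv^[((i + k : Fin 4) : ℕ)] z = rotInv^[(k : ℕ)] (rotInv^[(i : ℕ)] z) := by
  fin_cases i <;> fin_cases k <;> simp [rotInv]

lemma reduce_pair {X Y : Fin 4 → Set Plane} {f g : Plane → Plane}
    (hX : ∀ i z, z ∈ X i ↔ rotInv^[(i : ℕ)] z ∈ X 0)
    (hY : ∀ i z, z ∈ Y i ↔ rotInv^[(i : ℕ)] z ∈ Y 0)
    (h : ∀ (k : Fin 4) (z : Plane), z ∈ X 0 → rotInv^[(k : ℕ)] z ∈ Y 0 → f z = conjRot k g z) {i j : Fin 4} {z : Plane}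
    (hi : z ∈ X i) (hj : z ∈ Y j) : conjRot i f z = conjRot j g z := by
  obtain ⟨k, rfl⟩ : ∃ k, j = i + k := ⟨j - i, by abel⟩
  rw [hX] at hi
  rw [hY, rotInv_iter_add] at hj
  rw [conjRot_add, ← h k _ hi hj, conjRot]

lemma agree_AC {θ : ℝ} (hθ : θ ∈ Ioo 0 (Real.pi / 4)) {z : Plane} (h : z ∈ pieceA θ 0)
    (h' : z ∈ pieceC θ) : mapA θ z = mapC θ z := by
  rw [mem_A_zero hθ] at h
  rw [mem_C hθ] at h'
  obtain ⟨h1, h2, h3, h4⟩ := coords hθ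
  obtain ⟨x, y⟩ := z
  simp only [mapA, mapC] at *
  generalize sCoord θ = s at *
  generalize tCoord θ = t at *
  obtain ⟨a1, a2, a3⟩ := h
  obtain ⟨c1, c2, c3, c4⟩ := h'
  have hx : t * x = s * y := by linarith
  have hy : y = t := by
    have : t * y = t * t := by nlinarith
    exact mul_left_cancel₀ h1.ne' this
  subst hy
  obtain rfl : x = s := mul_left_cancel₀ h1.ne' (by linarith)
  ext <;> simp <;> field_simp <;> nlinarith

lemma agree_BC {θ : ℝ} (hθ : θ ∈ Ioo 0 (Real.pi / 4)) {z : Plane} (h : z ∈ pieceB θ 0)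
    (h' : z ∈ pieceC θ) : mapB θ z = mapC θ z := by
  rw [mem_B_zero hθ] at h
  rw [mem_C hθ] at h'
  obtain ⟨h1, h2, h3, h4⟩ := coords hθ
  obtain ⟨x, y⟩ := z
  simp only [mapB, mapC] at *
  generalize sCoord θ = s at *
  generalize tCoord θ = t at *
  obtain ⟨a1, a2, a3⟩ := h
  obtain ⟨c1, c2, c3, c4⟩ := h'
  have hx : t * (1 - y) = s * x := by linarith
  have hx' : s * (1 - y) = (1 - t) * x := mul_left_cancel₀ h1.ne' (by
    linear_combination s * hx + x * h4)
  have hts : t - s ≠ 0 := by linarith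
  ext
  · simp only
    rw [div_eq_iff hts]
    linear_combination -(2 * s - 1) * hx' + (x - 2 * y + 1) * h4
  · simp only
    rw [div_eq_iff hts]
    linear_combination -(1 - 2 * s) * hx + (2 * x + 2 * y - 1) * h4

lemma agree_AA {θ : ℝ} (hθ : θ ∈ Ioo 0 (Real.pi / 4)) (k : Fin 4) (z : Plane)
    (h : z ∈ pieceA θ 0) (h' : rotInv^[(k : ℕ)] z ∈ pieceA θ 0) :
    mapA θ z = conjRot k (mapA θ) z := by
  rw [mem_A_zero hθ] at h h'
  obtain ⟨h1, h2, h3, h4⟩ := coords hθ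
  obtain ⟨x, y⟩ := z
  obtain ⟨a1, a2, a3⟩ := h
  obtain ⟨c1, c2, c3⟩ := h'
  fin_cases k <;> simp [conjRot, mapA, rot, rotInv] at *
  all_goals
    generalize sCoord θ = s at *
    generalize tCoord θ = t at *
  · have hy : y = 0 := by
      have : 0 ≤ y * (t - s) := by nlinarith
      nlinarith
    subst hy
    have : x = 1 := by nlinarith
    subst this
    simp
  · exfalso; nlinarith
  · have hx : x = 0 := by
      have : 0 ≤ x * (t - s) := by nlinarith
      nlinarith
    subst hx
    have : y = 0 := by nlinarith
    subst this
    simp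

lemma agree_AB {θ : ℝ} (hθ : θ ∈ Ioo 0 (Real.pi / 4)) (k : Fin 4) (z : Plane)
    (h : z ∈ pieceA θ 0) (h' : rotInv^[(k : ℕ)] z ∈ pieceB θ 0) :
    mapA θ z = conjRot k (mapB θ) z := by
  rw [mem_A_zero hθ] at h
  rw [mem_B_zero hθ] at h'
  obtain ⟨h1, h2, h3, h4⟩ := coords hθ
  obtain ⟨x, y⟩ := z
  obtain ⟨a1, a2, a3⟩ := h
  obtain ⟨c1, c2, c3⟩ := h'
  fin_cases k <;> simp [conjRot, mapA, mapB, rot, rotInv] at *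
  all_goals
    generalize sCoord θ = s at *
    generalize tCoord θ = t at *
  · have hts : t - s ≠ 0 := by linarith
    obtain ⟨l, rfl⟩ : ∃ l, y = t * l := ⟨y / t, by field_simp⟩
    obtain rfl : x = s * l := mul_left_cancel₀ h1.ne' (by linarith)
    have e : (1 - 2 * s) / t * (t * l) = (1 - 2 * s) * l := by field_simp
    rw [e]
    constructor
    · rw [eq_div_iff hts]
      linear_combination -l * (1 - s) * h4
    · rw [eq_div_iff hts]
      linear_combination -2 * t * l * h4
  · have hts : t - s ≠ 0 := by linarith
    obtain ⟨l, rfl⟩ : ∃ l, y = t * l := ⟨y / t, by field_simp⟩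
    obtain rfl : x = 1 - (1 - s) * l := mul_left_cancel₀ h1.ne' (by linarith)
    have e : (1 - 2 * s) / t * (t * l) = (1 - 2 * s) * l := by field_simp
    rw [e]
    constructor
    · rw [eq_sub_iff_add_eq, ← eq_sub_iff_add_eq', div_eq_iff hts]
      linear_combination l * h4
    · rw [eq_div_iff hts]
      linear_combination -l * t * h4
  · exfalso; nlinarith
  · exfalso; nlinarith

lemma agree_BB {θ : ℝ} (hθ : θ ∈ Ioo 0 (Real.pi / 4)) (k : Fin 4) (z : Plane)
    (h : z ∈ pieceB θ 0) (h' : rotInv^[(k : ℕ)] z ∈ pieceB θ 0) :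
    mapB θ z = conjRot k (mapB θ) z := by
  rw [mem_B_zero hθ] at h h'
  obtain ⟨h1, h2, h3, h4⟩ := coords hθ
  obtain ⟨x, y⟩ := z
  obtain ⟨a1, a2, a3⟩ := h
  obtain ⟨c1, c2, c3⟩ := h'
  fin_cases k <;> simp [conjRot, mapB, rot, rotInv] at *
  all_goals
    generalize sCoord θ = s at *
    generalize tCoord θ = t at *
    have hts : t - s ≠ 0 := by linarith
  · have hx : t * x = s * y := by linarith
    have hy : y = t := by
      have : t * (t - y) = t * (t * (1 - y) - s * x) + s * (t * x - s * y) + y * (s ^ 2 - t + t ^ 2)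
        := by ring
      nlinarith
    obtain rfl : t = y := hy.symm
    obtain rfl : s = x := mul_left_cancel₀ h1.ne' (by linarith)
    have n1 : (t ^ 2 - (1 - s) ^ 2) * s + (1 - 2 * s) * t * t = (1 - s) * (t - s) := by
      linear_combination (1 - s) * h4
    have n2 : (2 * s - 1) * t * s + (2 * t - 1) * t * t = t * (t - s) := by
      linear_combination 2 * t * h4
    have n3 : (t ^ 2 - (1 - s) ^ 2) * t + (1 - 2 * s) * t * (1 - s) = t * (t - s) := by
      linear_combination t * h4
    have n4 : (2 * s - 1) * t * t + (2 * t - 1) * t * (1 - s) = s * (t - s) := by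
      linear_combination h4
    rw [n1, n2, n3, n4]
    constructor <;> field_simp
  · exfalso; nlinarith
  · have hx : t * (1 - y) = s * x := by linarith
    have hy : x = t := by
      have : t * (t - x) = t * (t * (1 - x) - s * (1 - y)) + s * (t * (1 - y) - s * x)
        + x * (s ^ 2 - t + t ^ 2) := by ring
      nlinarith
    obtain rfl : t = x := hy.symm
    obtain rfl : y = 1 - s := mul_left_cancel₀ h1.ne' (by linarith)
    have n1 : (t ^ 2 - (1 - s) ^ 2) * s + (1 - 2 * s) * t * t = (1 - s) * (t - s) := by
      linear_combination (1 - s) * h4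
    have n2 : (2 * s - 1) * t * s + (2 * t - 1) * t * t = t * (t - s) := by
      linear_combination 2 * t * h4
    have n3 : (t ^ 2 - (1 - s) ^ 2) * t + (1 - 2 * s) * t * (1 - s) = t * (t - s) := by
      linear_combination t * h4
    have n4 : (2 * s - 1) * t * t + (2 * t - 1) * t * (1 - s) = s * (t - s) := by
      linear_combination h4
    rw [sub_sub_cancel, n1, n2, n3, n4]
    constructor <;> field_simp
    ring

/-- The map is given by the expected affine map on every piece. -/
lemma F_of_mem_C (θ : ℝ) {z : Plane} (h : z ∈ pieceC θ) : F θ z = mapC θ z := by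
  rw [F, if_pos h]

lemma F_of_mem_A {θ : ℝ} (hθ : θ ∈ Ioo 0 (Real.pi / 4)) {i : Fin 4} {z : Plane}
    (h : z ∈ pieceA θ i) : F θ z = conjRot i (mapA θ) z := by
  have hC : ∀ {i : Fin 4}, z ∈ pieceA θ i → z ∈ pieceC θ → conjRot i (mapA θ) z = mapC θ z := by
    intro i h h'
    rw [← conjRot_mapC θ i z, conjRot, conjRot,
      agree_AC hθ ((mem_A_iff θ i z).1 h) ((rotInv_iter_mem_C hθ _ z).2 h')]
  unfold F
  split_ifs with h1 h2 h3
  · exact (hC h h1).symm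
  · exact reduce_pair (mem_A_iff θ) (mem_A_iff θ) (agree_AA hθ) h2.choose_spec h
  · exact absurd ⟨i, h⟩ h2
  · exact absurd ⟨i, h⟩ h2

lemma F_of_mem_B {θ : ℝ} (hθ : θ ∈ Ioo 0 (Real.pi / 4)) {i : Fin 4} {z : Plane}
    (h : z ∈ pieceB θ i) : F θ z = conjRot i (mapB θ) z := by
  unfold F
  split_ifs with h1 h2 h3
  · rw [← conjRot_mapC θ i z, conjRot, conjRot,
      agree_BC hθ ((mem_B_iff θ i z).1 h) ((rotInv_iter_mem_C hθ _ z).2 h1)]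
  · exact reduce_pair (mem_A_iff θ) (mem_B_iff θ) (agree_AB hθ) h2.choose_spec h
  · exact reduce_pair (mem_B_iff θ) (mem_B_iff θ) (agree_BB hθ) h3.choose_spec h
  · exact absurd ⟨i, h⟩ h3

lemma F_E {θ : ℝ} (hθ : θ ∈ Ioo 0 (Real.pi / 4)) (i : Fin 4) : F θ (E i) = E i := by
  rw [F_of_mem_A hθ (subset_convexHull ℝ _ (by simp) : E i ∈ pieceA θ i), conjRot, E,
    rotInv_iter_rot_iter]
  simp [mapA]

lemma F_P {θ : ℝ} (hθ : θ ∈ Ioo 0 (Real.pi / 4)) (i : Fin 4) : F θ (P θ i) = P' θ i := by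
  rw [F_of_mem_A hθ (subset_convexHull ℝ _ (by simp) : P θ i ∈ pieceA θ i), conjRot, P, P',
    rotInv_iter_rot_iter]
  have := (coords hθ).1.ne'
  congr 1
  ext <;> simp [mapA]
  field_simp
  ring

lemma mem_square {z : Plane} : z ∈ square ↔ 0 ≤ z.1 ∧ z.1 ≤ 1 ∧ 0 ≤ z.2 ∧ z.2 ≤ 1 :=
  ⟨fun h => ⟨h.1.1, h.1.2, h.2.1, h.2.2⟩, fun h => ⟨⟨h.1, h.2.1⟩, h.2.2⟩⟩

lemma square_rotInv {n : ℕ} {z : Plane} : rotInv^[n] z ∈ square ↔ z ∈ square := by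
  induction n with
  | zero => simp
  | succ n ih =>
    rw [Function.iterate_succ_apply', ← ih]
    simp only [rotInv, square, mem_prod, mem_Icc]
    constructor <;> rintro ⟨⟨_, _⟩, _, _⟩ <;> refine ⟨⟨?_, ?_⟩, ?_, ?_⟩ <;> linarith

lemma tile_step {θ : ℝ} (hθ : θ ∈ Ioo 0 (Real.pi / 4)) {z : Plane} (hz : z ∈ square)
    (h : 0 < tCoord θ * z.1 - sCoord θ * z.2) :
    (∃ i, z ∈ pieceA θ i) ∨ ∃ i, z ∈ pieceB θ i := by
  have m0 := mem_A_zero hθ z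
  have m1 := mem_A_iff θ 1 z
  have n1 := mem_B_iff θ 1 z
  have n2 := mem_B_iff θ 2 z
  have h22 : ((2 : Fin 4) : ℕ) = 2 := rfl
  rw [mem_A_zero hθ] at m1
  rw [mem_B_zero hθ] at n1 n2
  obtain ⟨h1, h2, h3, h4⟩ := coords hθ
  obtain ⟨⟨x0, x1⟩, y0, y1⟩ := hz
  simp only [Fin.val_one, h22, Function.iterate_succ, Function.iterate_zero, Function.comp_apply,
    id, rotInv] at m0 m1 n1 n2
  change 0 ≤ z.1 at x0
  change z.1 ≤ 1 at x1
  change 0 ≤ z.2 at y0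
  change z.2 ≤ 1 at y1
  by_cases e1 : 0 ≤ tCoord θ * (1 - z.1) - (1 - sCoord θ) * z.2
  · exact Or.inl ⟨0, m0.2 ⟨y0, h.le, e1⟩⟩
  by_cases e2 : tCoord θ * z.2 - sCoord θ * (1 - z.1) ≤ 0
  · exact Or.inr ⟨1, n1.2 ⟨e2, by linarith, by linarith⟩⟩
  by_cases e3 : 0 ≤ tCoord θ * (1 - z.2) - (1 - sCoord θ) * (1 - z.1)
  · exact Or.inl ⟨1, m1.2 ⟨by linarith, by linarith, e3⟩⟩
  · exact Or.inr ⟨2, n2.2 ⟨by linarith, by linarith, by linarith⟩⟩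

/-- The pieces tile the unit square. -/
lemma mem_square_iff {θ : ℝ} (hθ : θ ∈ Ioo 0 (Real.pi / 4)) (z : Plane) : z ∈ square ↔
    z ∈ pieceC θ ∨ (∃ i, z ∈ pieceA θ i) ∨ ∃ i, z ∈ pieceB θ i := by
  constructor
  · intro hz
    have step : ∀ i : Fin 4, 0 < tCoord θ * (rotInv^[(i : ℕ)] z).1
        - sCoord θ * (rotInv^[(i : ℕ)] z).2 → (∃ i, z ∈ pieceA θ i) ∨ ∃ i, z ∈ pieceB θ i := by
      intro i hi
      rcases tile_step hθ (square_rotInv.2 hz) hi with ⟨k, hk⟩ | ⟨k, hk⟩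
      · rw [mem_A_iff, ← rotInv_iter_add, ← mem_A_iff] at hk
        exact Or.inl ⟨_, hk⟩
      · rw [mem_B_iff, ← rotInv_iter_add, ← mem_B_iff] at hk
        exact Or.inr ⟨_, hk⟩
    by_contra hcon
    push Not at hcon
    have hn : ¬ ((∃ i, z ∈ pieceA θ i) ∨ ∃ i, z ∈ pieceB θ i) := by
      rintro (⟨i, hi⟩ | ⟨i, hi⟩)
      · exact hcon.2.1 i hi
      · exact hcon.2.2 i hi
    apply hcon.1
    rw [mem_C hθ]
    have k0 := not_lt.1 (fun h => hn (step 0 h))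
    have k1 := not_lt.1 (fun h => hn (step 1 h))
    have k2 := not_lt.1 (fun h => hn (step 2 h))
    have k3 := not_lt.1 (fun h => hn (step 3 h))
    simp [rotInv] at k0 k1 k2 k3
    exact ⟨by linarith, by linarith, by linarith, by linarith⟩
  · obtain ⟨h1, h2, h3, h4⟩ := coords hθ
    rintro (h | ⟨i, h⟩ | ⟨i, h⟩)
    · rw [mem_C hθ] at h
      obtain ⟨c1, c2, c3, c4⟩ := h
      generalize sCoord θ = s at *
      generalize tCoord θ = t at *
      refine mem_square.2 ⟨?_, ?_, ?_, ?_⟩ <;> nlinarith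
    · rw [mem_A_iff, mem_A_zero hθ] at h
      refine (square_rotInv (n := i)).1 ?_
      generalize rotInv^[(i : ℕ)] z = w at *
      obtain ⟨c1, c2, c3⟩ := h
      generalize sCoord θ = s at *
      generalize tCoord θ = t at *
      refine mem_square.2 ⟨?_, ?_, ?_, ?_⟩ <;> nlinarith
    · rw [mem_B_iff, mem_B_zero hθ] at h
      refine (square_rotInv (n := i)).1 ?_
      generalize rotInv^[(i : ℕ)] z = w at *
      obtain ⟨c1, c2, c3⟩ := h
      generalize sCoord θ = s at *
      generalize tCoord θ = t at *
      refine mem_square.2 ⟨?_, ?_, ?_, ?_⟩ <;> nlinarith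

lemma refl_rot_iter (i : Fin 4) (u : Plane) :
    mirror (rot^[(i : ℕ)] u) = rot^[((-i : Fin 4) : ℕ)] (mirror u) := by
  fin_cases i <;> simp [rot, mirror, show (-1 : Fin 4) = 3 from rfl, show (-2 : Fin 4) = 2 from rfl,
    show (-3 : Fin 4) = 1 from rfl]

lemma refl_mapA_mem {θ : ℝ} (hθ : θ ∈ Ioo 0 (Real.pi / 4)) {w : Plane} (h : w ∈ pieceA θ 0) :
    mirror (mapA θ w) ∈ pieceA θ 0 := by
  have ht := (coords hθ).1.ne'
  refine (respects_refl.comp (respects_mapA θ)).mem ?_ h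
  rintro z (rfl | rfl | rfl) <;> apply subset_convexHull <;>
    simp [E, P, rot, mapA, mirror]
  right
  right
  field_simp
  ring

lemma refl_mapB_mem {θ : ℝ} (hθ : θ ∈ Ioo 0 (Real.pi / 4)) {w : Plane} (h : w ∈ pieceB θ 0) :
    mirror (mapB θ w) ∈ pieceB θ 1 := by
  obtain ⟨h1, h2, h3, h4⟩ := coords hθ
  have hts : tCoord θ - sCoord θ ≠ 0 := by linarith
  refine (respects_refl.comp (respects_mapB θ)).mem ?_ h
  have e0 : mirror (mapB θ (E 0)) = E 0 + (1, 0) := by simp [E, mapB, mirror]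
  have e1 : mirror (mapB θ (P θ 0)) = P θ 0 := by
    simp only [P, mapB, mirror, Fin.val_zero, Function.iterate_zero, id]
    generalize sCoord θ = s at *
    generalize tCoord θ = t at *
    ext <;> simp only
    · rw [sub_eq_iff_eq_add, ← sub_eq_iff_eq_add', eq_div_iff hts]
      linear_combination -(1 - s) * h4
    · rw [div_eq_iff hts]
      linear_combination 2 * t * h4
  have e2 : mirror (mapB θ (P θ (0 - 1))) = P θ 1 := by
    have h33 : (((0 - 1 : Fin 4)) : ℕ) = 3 := rfl
    simp only [P, mapB, mirror, h33, Fin.val_one, Function.iterate_succ, Function.iterate_zero,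
      Function.comp_apply, id, rot, sub_sub_cancel]
    generalize sCoord θ = s at *
    generalize tCoord θ = t at *
    ext <;> simp only
    · rw [sub_right_inj, div_eq_iff hts]
      linear_combination t * h4
    · rw [div_eq_iff hts]
      linear_combination h4
  rintro z (rfl | rfl | rfl) <;> apply subset_convexHull
  · left
    rw [Function.comp_apply, e0]
    simp [E, rot]
  · right; right
    rw [Function.comp_apply, e1]
    simp
  · right; left
    rw [Function.comp_apply, e2]

lemma refl_mapC_mem {θ : ℝ} (hθ : θ ∈ Ioo 0 (Real.pi / 4)) {w : Plane} (h : w ∈ pieceC θ) :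
    mirror (mapC θ w) ∈ pieceC θ := by
  obtain ⟨h1, h2, h3, h4⟩ := coords hθ
  rw [mem_C hθ] at h ⊢
  obtain ⟨c1, c2, c3, c4⟩ := h
  simp only [mirror, mapC]
  generalize sCoord θ = s at *
  generalize tCoord θ = t at *
  obtain ⟨x, y⟩ := w
  simp only at *
  have e1 : t * (1 - (2 * s * x + (2 * t - 1) * y + (1 - t - s)))
      - s * ((1 - 2 * t) * x + 2 * s * y + (t - s)) = t * (1 - y) - s * x := by
    linear_combination (1 - 2 * y) * h4
  have e2 : t * ((1 - 2 * t) * x + 2 * s * y + (t - s))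
      - s * (2 * s * x + (2 * t - 1) * y + (1 - t - s)) = t * (1 - x) - s * (1 - y) := by
    linear_combination (1 - 2 * x) * h4
  refine ⟨?_, ?_, ?_, ?_⟩ <;> linarith

/-- The map is inverted by conjugation with a reflection. -/
lemma refl_F_refl_F {θ : ℝ} (hθ : θ ∈ Ioo 0 (Real.pi / 4)) (z : Plane) :
    mirror (F θ (mirror (F θ z))) = z := by
  by_cases hz : z ∈ square
  · obtain ⟨h1, h2, h3, h4⟩ := coords hθ
    have hts : tCoord θ - sCoord θ ≠ 0 := by linarith
    rcases (mem_square_iff hθ z).1 hz with h | ⟨i, h⟩ | ⟨i, h⟩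
    · rw [F_of_mem_C θ h, F_of_mem_C θ (refl_mapC_mem hθ h)]
      simp only [mirror, mapC]
      ext
      · linear_combination (4 * z.1 - 2) * h4
      · linear_combination (4 * z.2 - 2) * h4
    · have h0 := (mem_A_iff θ i z).1 h
      have h5 := refl_mapA_mem hθ h0
      rw [F_of_mem_A hθ h, conjRot, refl_rot_iter]
      have h6 : rot^[((-i : Fin 4) : ℕ)] (mirror (mapA θ (rotInv^[(i : ℕ)] z))) ∈ pieceA θ (-i) := by
        rwa [mem_A_iff, rotInv_iter_rot_iter]
      rw [F_of_mem_A hθ h6, conjRot, rotInv_iter_rot_iter, refl_rot_iter, neg_neg]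
      have : ∀ w, mirror (mapA θ (mirror (mapA θ w))) = w := by
        intro w
        ext <;> simp [mirror, mapA]
        ring
      rw [this, rot_iter_rotInv_iter]
    · have h0 := (mem_B_iff θ i z).1 h
      have h5 := refl_mapB_mem hθ h0
      rw [F_of_mem_B hθ h, conjRot, refl_rot_iter]
      have h6 : rot^[((-i : Fin 4) : ℕ)] (mirror (mapB θ (rotInv^[(i : ℕ)] z)))
          ∈ pieceB θ (-i + 1) := by
        rwa [mem_B_iff, rotInv_iter_add, rotInv_iter_rot_iter, ← mem_B_iff]
      rw [F_of_mem_B hθ h6, conjRot_add, rotInv_iter_rot_iter, refl_rot_iter, neg_neg]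
      have : ∀ w, mirror (conjRot 1 (mapB θ) (mirror (mapB θ w))) = w := by
        intro w
        simp only [mirror, conjRot, mapB, Fin.val_one, Function.iterate_one, rot, rotInv,
          sub_sub_cancel]
        generalize sCoord θ = s at *
        generalize tCoord θ = t at *
        ext
        · simp only
          field_simp
          linear_combination w.1 * (2 * t ^ 2 + t - 1) * h4
        · simp only
          field_simp
          linear_combination w.2 * (2 * t ^ 2 + t - 1) * h4
      rw [this, rot_iter_rotInv_iter]
  · have hr : mirror z ∉ square := by
      intro h
      apply hz
      obtain ⟨⟨a, b⟩, c, d⟩ := h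
      simp [mirror] at a b c d
      exact ⟨⟨b, a⟩, c, d⟩
    have fix : ∀ w, w ∉ square → F θ w = w := by
      intro w hw
      rw [mem_square_iff hθ] at hw
      push Not at hw
      rw [F, if_neg hw.1, dif_neg (by simpa using hw.2.1), dif_neg (by simpa using hw.2.2)]
    rw [fix z hz, fix _ hr, refl_refl]

/-- The map as a bijection of the plane. -/
noncomputable def FPerm (θ : ℝ) (hθ : θ ∈ Ioo 0 (Real.pi / 4)) : Equiv.Perm Plane where
  toFun := F θ
  invFun := fun z => mirror (F θ (mirror z))
  left_inv := refl_F_refl_F hθ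
  right_inv := fun z => by
    have := refl_F_refl_F hθ (mirror z)
    simpa using congrArg mirror this

/-! Invariant circles, rotation numbers, orbits. -/

/-- `γ` is a counterclockwise parametrization, with period `1`, of the simple closed curve `Γ`, which
encircles `Z`: `γ` is continuous, injective modulo `1`, and its angle about `Z` increases by `2π`
over one period (the winding number about `Z` is `1`). -/
structure IsParam (Γ : Set Plane) (γ : ℝ → Plane) : Prop where
  continuous : Continuous γ
  periodic : Function.Periodic γ 1
  injective : ∀ x y : ℝ, γ x = γ y → ∃ n : ℤ, y = x + n
  range_eq : range γ = Γ
  encircles : ∃ r φ : ℝ → ℝ, Continuous φ ∧ (∀ x, 0 < r x) ∧ (∀ x, φ (x + 1) = φ x + 2 * Real.pi) ∧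
    ∀ x, γ x = Z + (r x * Real.cos (φ x), r x * Real.sin (φ x))

/-- `f` is a lift of `F θ` on the curve parametrized by `γ`: a monotone map of the line which
commutes with `x ↦ x + 1`. -/
def IsLift (θ : ℝ) (γ : ℝ → Plane) (f : CircleDeg1Lift) : Prop :=
  ∀ x, F θ (γ x) = γ (f x)

/-- An invariant circle: a simple closed curve in the unit square which encircles `Z`, is mapped
onto itself by `F θ`, and on which `F θ` preserves the cyclic order of points (that is, has a
monotone degree one lift). -/
structure IsInvariantCircle (θ : ℝ) (Γ : Set Plane) : Prop where
  subset_square : Γ ⊆ square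
  image_eq : F θ '' Γ = Γ
  order : ∃ γ, IsParam Γ γ ∧ ∃ f, IsLift θ γ f

/-- A rotationally symmetric set. -/
def IsRotSymm (Γ : Set Plane) : Prop := rot '' Γ = Γ

/-- The restriction of `F θ` to the circle `Γ` has rotation number `ρ` (modulo `1`). -/
def HasRotationNumber (θ : ℝ) (Γ : Set Plane) (ρ : ℝ) : Prop :=
  ∃ γ f, IsParam Γ γ ∧ IsLift θ γ f ∧ ∃ n : ℤ, f.translationNumber = ρ + n

/-- The two-sided orbit of `X`. -/
def orbit (θ : ℝ) (hθ : θ ∈ Ioo 0 (Real.pi / 4)) (X : Plane) : Set Plane :=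
  {Y | ∃ n : ℤ, (FPerm θ hθ ^ n) X = Y}

/-- Along the orbit of `X` the visits to `S` and to `T` alternate: between any two visits to one of
the sets there is a visit to the other. (The earlier of the two times is allowed, which matters only
for points of `S ∩ T`.) -/
def VisitsAlternate (θ : ℝ) (hθ : θ ∈ Ioo 0 (Real.pi / 4)) (X : Plane) (S T : Set Plane) : Prop :=
  ∀ m n : ℤ, m < n →
    ((FPerm θ hθ ^ m) X ∈ S → (FPerm θ hθ ^ n) X ∈ S →
      ∃ k, m ≤ k ∧ k < n ∧ (FPerm θ hθ ^ k) X ∈ T) ∧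
    ((FPerm θ hθ ^ m) X ∈ T → (FPerm θ hθ ^ n) X ∈ T →
      ∃ k, m ≤ k ∧ k < n ∧ (FPerm θ hθ ^ k) X ∈ S)

end NinePiece

open NinePiece

/-!
Since `F θ` commutes with the rotation `rot`, which permutes the points `U i` as well as the points
`V j` cyclically, everything follows once a single `U i` and a single `V j` lie on the same orbit
(`IsBreakPoints.exists_zpow_eq`): then one fixed power of `F θ` takes every `U i` to some `V j`, and
the two kinds of points are visited alternately (`exists_visit_between`). Moreover, if an orbit
contains two of the `U i`, then some nonzero power `g` of `F θ` acts on one of them as a power of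
`rot` does, and the fourth power of `g` fixes it.

Suppose that no orbit contains both kinds of points. Then no `U i` is a `V j`, so the curve avoids
the corners of the square, and at each of the eight break points it passes from one of the eight
outer pieces to the next (`SectorSystem.crossing`). There the linear parts of `F θ` on the two sides
of the break segment differ by a nontrivial shear along it (`IsCorner`). All linear parts preserve
the oriented area.

* Suppose that the orbit of a break point `X` never returns to a break point. The rotation number is
  rational, so under a suitable iterate of the map the far past and the far future of `X` converge to
  fixed points. Near a fixed point this iterate is affine on either side, hence it preserves the areas
  of the triangles spanned by the fixed point and two points of the curve, while these areas tend to
  zero in the future or in the past. So the areas vanish, and the curve is straight near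
  points of the orbit of `X` in the far past and in the far future (`flatAt_iterate`). Straightness
  propagates along the orbit except at `X`, so the curve is straight at `X` and at its image, which
  contradicts the shear (`SectorSystem.not_flatAt_map`, `SectorSystem.exists_return`).
* Hence all break points are periodic. The same argument with areas shows that some iterate of the map
  is the identity on the whole curve (`SectorSystem.iterate_eq_self`). Take the first return of `U 0`
  to the points `U i`, composed with the power of the rotation that brings it back to `U 0`. This map
  preserves the orientation of the curve, for which the rotation is lifted to the line of parameters
  (`IsClosedCurve.exists_lift`), and it has finite order and a fixed point, so it is the identity.
  But its linear parts on the two sides of `U 0` differ by a shear, and two such maps cannot both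
  have fixed vectors transversal to the break segment (`not_fixed_both_sides`,
  `SectorSystem.not_return_symm`).
-/

namespace NinePiece
open Filter Topology

/-! ### Oriented area and straight pieces of curves -/

/-- The oriented area of the parallelogram spanned by two vectors. -/
def area (v w : Plane) : ℝ := v.1 * w.2 - v.2 * w.1

lemma continuous_area : Continuous fun q : Plane × Plane => area q.1 q.2 := by
  unfold area; fun_prop

@[simp] lemma area_self (v : Plane) : area v v = 0 := by simp [area, mul_comm]

lemma area_sub_sub (u v w : Plane) : area (u - w) (v - w) = area u v - area u w - area w v := by
  simp [area]; ring

lemma area_smul_right (r : ℝ) (v w : Plane) : area v (r • w) = r * area v w := by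
  simp [area]; ring

lemma area_swap (v w : Plane) : area v w = -area w v := by
  simp [area]; ring

lemma exists_smul_of_area_eq_zero {v w : Plane} (hv : v ≠ 0) (h : area v w = 0) :
    ∃ r : ℝ, w = r • v := by
  obtain ⟨a, b⟩ := v
  obtain ⟨c, d⟩ := w
  simp only [area] at h
  by_cases ha : a = 0
  · have hb : b ≠ 0 := fun hb => hv (by simp [ha, hb])
    refine ⟨d / b, ?_⟩
    subst ha
    have : c = 0 := by simpa [hb] using h
    ext <;> simp [this, hb]
  · refine ⟨c / a, ?_⟩
    ext
    · simp [ha]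
    · simp only [Prod.smul_mk, smul_eq_mul]
      field_simp
      linarith

/-- The curve `γ` is straight near the parameter `x`: any two points of the curve near `γ x` are
collinear with `γ x`. -/
def FlatAt (γ : ℝ → Plane) (x : ℝ) : Prop :=
  ∀ᶠ q : ℝ × ℝ in 𝓝 (x, x), area (γ q.1 - γ x) (γ q.2 - γ x) = 0

lemma FlatAt.neg {γ : ℝ → Plane} {x : ℝ} (h : FlatAt (fun y => γ (-y)) (-x)) : FlatAt γ x := by
  have ht : Tendsto (fun q : ℝ × ℝ => (-q.1, -q.2)) (𝓝 (x, x)) (𝓝 (-x, -x)) :=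
    Continuous.tendsto (by fun_prop) (x, x)
  have := ht.eventually h
  simpa [FlatAt] using this

lemma FlatAt.add_int {γ : ℝ → Plane} (hγ : Function.Periodic γ 1) {x : ℝ} {n : ℤ}
    (h : FlatAt γ (x + n)) : FlatAt γ x := by
  have ht : Tendsto (fun q : ℝ × ℝ => (q.1 + n, q.2 + n)) (𝓝 (x, x)) (𝓝 (x + n, x + n)) :=
    Continuous.tendsto (f := fun q : ℝ × ℝ => (q.1 + n, q.2 + n)) (by fun_prop) (x, x)
  have hp : ∀ y, γ (y + n) = γ y := fun y => by simpa using hγ.int_mul n y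
  have := ht.eventually h
  simpa [FlatAt, hp] using this

lemma iterate_neg_conj (h : ℝ → ℝ) (n : ℕ) (x : ℝ) :
    (fun x => -h (-x))^[n] x = -h^[n] (-x) := by
  induction n generalizing x with
  | zero => simp
  | succ n ih => rw [Function.iterate_succ_apply, Function.iterate_succ_apply, ih, neg_neg]

/-- An increasing orbit converges to a fixed point `b`. If `h` preserves the areas of the triangles
formed by `γ b` and two points of the curve shortly before it, then these areas vanish, because they
tend to zero along the orbits, and so the curve is straight there. -/
lemma flatAt_iterate_of_lt {γ : ℝ → Plane} (hγ : Continuous γ) {h : ℝ → ℝ} (hm : StrictMono h)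
    (hc : Continuous h) {u p : ℝ} (hu : u < h u) (hup : u < p) (hp : h p = p)
    (hinv : ∀ b, h b = b → ∃ c < b, ∀ x ∈ Ioo c b, ∀ y ∈ Ioo c b,
      area (γ (h x) - γ b) (γ (h y) - γ b) = area (γ x - γ b) (γ y - γ b)) :
    ∃ N, ∀ n ≥ N, FlatAt γ (h^[n] u) := by
  have hmono : StrictMono fun n => h^[n] u := by
    refine strictMono_nat_of_lt_succ fun n => ?_
    rw [Function.iterate_succ_apply]
    exact hm.iterate n hu
  have hbdd : BddAbove (range fun n => h^[n] u) := by
    refine ⟨p, ?_⟩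
    rintro _ ⟨n, rfl⟩
    have := (hm.iterate n).monotone hup.le
    rwa [Function.iterate_fixed hp] at this
  have hlim := tendsto_atTop_ciSup hmono.monotone hbdd
  set b := ⨆ n, h^[n] u with hb
  have hfix : h b = b := isFixedPt_of_tendsto_iterate hlim hc.continuousAt
  have hlt : ∀ n, h^[n] u < b := fun n =>
    (hmono (Nat.lt_succ_self n)).trans_le (le_ciSup hbdd (n + 1))
  obtain ⟨c, hcb, hcc⟩ := hinv b hfix
  obtain ⟨N, hN⟩ := (hlim.eventually (lt_mem_nhds hcb)).exists
  have hstay : ∀ y ∈ Ioo (h^[N] u) b, ∀ k, h^[k] y ∈ Ioo c b ∧ h^[N + k] u ≤ h^[k] y := by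
    intro y hy k
    have h1 : h^[N + k] u ≤ h^[k] y := by
      rw [add_comm, Function.iterate_add_apply]
      exact (hm.iterate k).monotone hy.1.le
    refine ⟨⟨hN.trans_le ((hmono.monotone (Nat.le_add_right N k)).trans h1), ?_⟩, h1⟩
    have := hm.iterate k hy.2
    rwa [Function.iterate_fixed hfix] at this
  have hconv : ∀ y ∈ Ioo (h^[N] u) b, Tendsto (fun k => γ (h^[k] y) - γ b) atTop (𝓝 0) := by
    intro y hy
    have h1 : Tendsto (fun k => h^[N + k] u) atTop (𝓝 b) := by
      simpa only [add_comm] using (tendsto_add_atTop_iff_nat N).2 hlim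
    have h2 : Tendsto (fun k => h^[k] y) atTop (𝓝 b) :=
      tendsto_of_tendsto_of_tendsto_of_le_of_le h1 tendsto_const_nhds
        (fun k => (hstay y hy k).2) (fun k => (hstay y hy k).1.2.le)
    simpa using ((hγ.tendsto b).comp h2).sub_const (γ b)
  have hzero : ∀ y ∈ Ioo (h^[N] u) b, ∀ z ∈ Ioo (h^[N] u) b,
      area (γ y - γ b) (γ z - γ b) = 0 := by
    intro y hy z hz
    have hconst : ∀ k, area (γ (h^[k] y) - γ b) (γ (h^[k] z) - γ b)
        = area (γ y - γ b) (γ z - γ b) := by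
      intro k
      induction k with
      | zero => rfl
      | succ k ih =>
        rw [Function.iterate_succ_apply', Function.iterate_succ_apply', ← ih]
        exact hcc _ (hstay y hy k).1 _ (hstay z hz k).1
    have ht := (continuous_area.tendsto (0, 0)).comp
      ((hconv y hy).prodMk_nhds (hconv z hz))
    simp only [Function.comp_def, hconst] at ht
    simpa using tendsto_nhds_unique tendsto_const_nhds ht
  refine ⟨N + 1, fun n hn => ?_⟩
  have hx : h^[n] u ∈ Ioo (h^[N] u) b := ⟨hmono (by omega), hlt n⟩
  have hU : Ioo (h^[N] u) b ∈ 𝓝 (h^[n] u) := Ioo_mem_nhds hx.1 hx.2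
  rw [FlatAt, nhds_prod_eq]
  filter_upwards [prod_mem_prod hU hU] with q hq
  have e : ∀ y z : ℝ, γ y - γ z = (γ y - γ b) - (γ z - γ b) := fun y z => by abel
  rw [e q.1, e q.2, area_sub_sub, hzero _ hq.1 _ hq.2, hzero _ hq.1 _ hx, hzero _ hx _ hq.2]
  simp

lemma flatAt_iterate_of_gt {γ : ℝ → Plane} (hγ : Continuous γ) {h : ℝ → ℝ} (hm : StrictMono h)
    (hc : Continuous h) {u p : ℝ} (hu : h u < u) (hup : p < u) (hp : h p = p)
    (hinv : ∀ b, h b = b → ∃ c > b, ∀ x ∈ Ioo b c, ∀ y ∈ Ioo b c,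
      area (γ (h x) - γ b) (γ (h y) - γ b) = area (γ x - γ b) (γ y - γ b)) :
    ∃ N, ∀ n ≥ N, FlatAt γ (h^[n] u) := by
  obtain ⟨N, hN⟩ := flatAt_iterate_of_lt (γ := fun y => γ (-y)) (h := fun x => -h (-x))
    (u := -u) (p := -p) (by fun_prop) (fun x y hxy => neg_lt_neg (hm (neg_lt_neg hxy)))
    (by fun_prop) (by simpa using hu) (by simpa using hup) (by simp [hp]) (by
      intro b hb
      obtain ⟨c, hc, hcc⟩ := hinv (-b) (by rw [← neg_eq_iff_eq_neg, hb])
      refine ⟨-c, by linarith, fun x hx y hy => ?_⟩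
      simpa using hcc (-x) ⟨by linarith [hx.2], by linarith [hx.1]⟩ (-y)
        ⟨by linarith [hy.2], by linarith [hy.1]⟩)
  refine ⟨N, fun n hn => FlatAt.neg ?_⟩
  have := hN n hn
  rwa [iterate_neg_conj, neg_neg] at this

/-- If `h` preserves the areas of triangles with one vertex at a fixed point and two on the curve on
one side near it, then the curve is straight near all late points of every nonconstant orbit that is
confined between fixed points. -/
lemma flatAt_iterate {γ : ℝ → Plane} (hγ : Continuous γ) {h : ℝ → ℝ} (hm : StrictMono h)
    (hc : Continuous h) {u p p' : ℝ} (hu : h u ≠ u) (hpu : p < u) (hup : u < p')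
    (hp : h p = p) (hp' : h p' = p')
    (hleft : ∀ b, h b = b → ∃ c < b, ∀ x ∈ Ioo c b, ∀ y ∈ Ioo c b,
      area (γ (h x) - γ b) (γ (h y) - γ b) = area (γ x - γ b) (γ y - γ b))
    (hright : ∀ b, h b = b → ∃ c > b, ∀ x ∈ Ioo b c, ∀ y ∈ Ioo b c,
      area (γ (h x) - γ b) (γ (h y) - γ b) = area (γ x - γ b) (γ y - γ b)) :
    ∃ N, ∀ n ≥ N, FlatAt γ (h^[n] u) := by
  rcases hu.lt_or_gt with h1 | h1
  · exact flatAt_iterate_of_gt hγ hm hc h1 hpu hp hright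
  · exact flatAt_iterate_of_lt hγ hm hc h1 hup hp' hleft

/-! ### Curves cut into finitely many affine sectors -/

/-- `γ` is a parametrization, with period `1`, of the simple closed curve `Γ`. -/
structure IsClosedCurve (Γ : Set Plane) (γ : ℝ → Plane) : Prop where
  continuous : Continuous γ
  periodic : Function.Periodic γ 1
  injective : ∀ x y : ℝ, γ x = γ y → ∃ n : ℤ, y = x + n
  range_eq : range γ = Γ

/-- The curve `Γ` is covered by finitely many closed sectors `S i`, on each of which `Φ` is affine
with the area-preserving linear part `M i`. Distinct sectors meet on `Γ` only in the finite set `W`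
of break points, at least three in number, of which every sector contains at most two. -/
structure SectorSystem (Γ W : Set Plane) (Φ : Plane → Plane) {ι : Type*} (S : ι → Set Plane)
    (M : ι → Plane →ₗ[ℝ] Plane) : Prop where
  closed : ∀ i, IsClosed (S i)
  cover : ∀ z ∈ Γ, ∃ i, z ∈ S i
  map_sub : ∀ i, ∀ z ∈ S i, ∀ w ∈ S i, Φ z - Φ w = M i (z - w)
  area_map : ∀ i v w, area (M i v) (M i w) = area v w
  inter : ∀ i j, i ≠ j → ∀ z ∈ Γ, z ∈ S i → z ∈ S j → z ∈ W
  finite : W.Finite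
  subset : W ⊆ Γ
  two : ∀ i, (W ∩ S i).ncard ≤ 2
  three : 2 < W.ncard

namespace IsClosedCurve

variable {Γ : Set Plane} {γ : ℝ → Plane}

lemma mem (hγ : IsClosedCurve Γ γ) (x : ℝ) : γ x ∈ Γ := hγ.range_eq ▸ mem_range_self x

lemma add_int (hγ : IsClosedCurve Γ γ) (x : ℝ) (n : ℤ) : γ (x + n) = γ x := by
  simpa using hγ.periodic.int_mul n x

lemma exists_mem_Ico (hγ : IsClosedCurve Γ γ) {z : Plane} (hz : z ∈ Γ) (a : ℝ) :
    ∃ x ∈ Ico a (a + 1), γ x = z := by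
  obtain ⟨x, rfl⟩ := hγ.range_eq ▸ hz
  obtain ⟨m, hm, -⟩ := existsUnique_add_zsmul_mem_Ico (zero_lt_one' ℝ) x a
  refine ⟨_, hm, ?_⟩
  rw [zsmul_one]
  exact hγ.add_int x m

lemma neg (hγ : IsClosedCurve Γ γ) : IsClosedCurve Γ (fun x => γ (-x)) where
  continuous := hγ.continuous.comp continuous_neg
  periodic := fun x => by
    have := hγ.periodic.sub_eq (-x)
    rwa [← neg_add'] at this
  injective := fun x y h => by
    obtain ⟨n, hn⟩ := hγ.injective _ _ h
    exact ⟨-n, by push_cast; linarith⟩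
  range_eq := by
    rw [← hγ.range_eq]
    exact (Equiv.neg ℝ).surjective.range_comp γ

lemma one_le_sub (hγ : IsClosedCurve Γ γ) {x y : ℝ} (hxy : x < y) (h : γ x = γ y) : 1 ≤ y - x := by
  obtain ⟨n, rfl⟩ := hγ.injective _ _ h
  have : (0 : ℝ) < n := by linarith
  have h1 : (1 : ℤ) ≤ n := by exact_mod_cast this
  have : (1 : ℝ) ≤ n := by exact_mod_cast h1
  linarith

lemma exists_break_lt (hγ : IsClosedCurve Γ γ) {W : Set Plane} (hW : W.Finite) (hWΓ : W ⊆ Γ)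
    (hne : W.Nonempty) (x : ℝ) : ∃ c < x, γ c ∈ W ∧ ∀ y ∈ Ioo c x, γ y ∉ W := by
  have hinj : InjOn γ (Ico (x - 1) x ∩ γ ⁻¹' W) := by
    rintro a ⟨ha, -⟩ b ⟨hb, -⟩ hab
    rcases lt_trichotomy a b with h | h | h
    · linarith [hγ.one_le_sub h hab, ha.1, hb.2]
    · exact h
    · linarith [hγ.one_le_sub h hab.symm, hb.1, ha.2]
  have hfin : (Ico (x - 1) x ∩ γ ⁻¹' W).Finite :=
    Set.Finite.of_injOn (f := γ) (fun a ha => ha.2) hinj hW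
  obtain ⟨w, hw⟩ := hne
  obtain ⟨a, ha, rfl⟩ := hγ.exists_mem_Ico (hWΓ hw) (x - 1)
  rw [sub_add_cancel] at ha
  obtain ⟨c, hc, hmax⟩ := exists_max_image _ id hfin ⟨a, ha, hw⟩
  refine ⟨c, hc.1.2, hc.2, fun y hy hyW => ?_⟩
  have := hmax y ⟨⟨hc.1.1.trans hy.1.le, hy.2⟩, hyW⟩
  exact absurd hy.1 (not_lt.2 this)

lemma exists_break_gt (hγ : IsClosedCurve Γ γ) {W : Set Plane} (hW : W.Finite) (hWΓ : W ⊆ Γ)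
    (hne : W.Nonempty) (x : ℝ) : ∃ d > x, γ d ∈ W ∧ ∀ y ∈ Ioo x d, γ y ∉ W := by
  obtain ⟨c, hc, hcW, hgap⟩ := hγ.neg.exists_break_lt hW hWΓ hne (-x)
  refine ⟨-c, by linarith, hcW, fun y hy => ?_⟩
  have := hgap (-y) ⟨by linarith [hy.2], by linarith [hy.1]⟩
  rwa [neg_neg] at this

end IsClosedCurve

namespace SectorSystem

variable {Γ W : Set Plane} {γ : ℝ → Plane} {Φ : Plane → Plane} {ι : Type*}
  {S : ι → Set Plane} {M : ι → Plane →ₗ[ℝ] Plane}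

lemma nonempty (hS : SectorSystem Γ W Φ S M) : W.Nonempty :=
  nonempty_of_ncard_ne_zero (by have := hS.three; omega)

variable [Finite ι]

/-- An arc without break points lies in a single sector. -/
lemma exists_sector (hS : SectorSystem Γ W Φ S M) (hγ : IsClosedCurve Γ γ) {a b : ℝ} (hab : a < b)
    (hgap : ∀ y ∈ Ioo a b, γ y ∉ W) : ∃ i, ∀ y ∈ Icc a b, γ y ∈ S i := by
  obtain ⟨m, hm⟩ := nonempty_Ioo.2 hab
  obtain ⟨i, hi⟩ := hS.cover (γ m) (hγ.mem m)
  have hci : IsClosed (γ ⁻¹' S i) := (hS.closed i).preimage hγ.continuous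
  have hcj : IsClosed (γ ⁻¹' ⋃ j ∈ {j | j ≠ i}, S j) :=
    ((Set.toFinite _).isClosed_biUnion fun j _ => hS.closed j).preimage hγ.continuous
  have hdisj : ∀ y ∈ Ioo a b, y ∈ γ ⁻¹' S i → y ∉ γ ⁻¹' ⋃ j ∈ {j | j ≠ i}, S j := by
    intro y hy h1 h2
    obtain ⟨j, hj, h2⟩ := mem_iUnion₂.1 h2
    exact hgap y hy (hS.inter j i hj _ (hγ.mem y) h2 h1)
  have hsub := isPreconnected_iff_subset_of_disjoint_closed.1 (isPreconnected_Ioo (a := a) (b := b))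
    _ _ hci hcj (by
      intro y _
      obtain ⟨j, hj⟩ := hS.cover (γ y) (hγ.mem y)
      by_cases hji : j = i
      · exact Or.inl (hji ▸ hj)
      · exact Or.inr (mem_iUnion₂.2 ⟨j, hji, hj⟩))
    (by
      ext y
      simp only [mem_inter_iff, mem_empty_iff_false, iff_false]
      rintro ⟨hy, h1, h2⟩
      exact hdisj y hy h1 h2)
  refine ⟨i, ?_⟩
  rcases hsub with h | h
  · have := closure_minimal h hci
    rwa [closure_Ioo hab.ne] at this
  · exact absurd (h hm) (hdisj m hm hi)

lemma exists_left_sector (hS : SectorSystem Γ W Φ S M) (hγ : IsClosedCurve Γ γ) (x : ℝ) :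
    ∃ i, ∃ c < x, ∀ y ∈ Icc c x, γ y ∈ S i := by
  obtain ⟨c, hc, -, hgap⟩ := hγ.exists_break_lt hS.finite hS.subset hS.nonempty x
  obtain ⟨i, hi⟩ := hS.exists_sector hγ hc hgap
  exact ⟨i, c, hc, hi⟩

lemma exists_right_sector (hS : SectorSystem Γ W Φ S M) (hγ : IsClosedCurve Γ γ) (x : ℝ) :
    ∃ i, ∃ d > x, ∀ y ∈ Icc x d, γ y ∈ S i := by
  obtain ⟨d, hd, -, hgap⟩ := hγ.exists_break_gt hS.finite hS.subset hS.nonempty x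
  obtain ⟨i, hi⟩ := hS.exists_sector hγ hd hgap
  exact ⟨i, d, hd, hi⟩

/-- At a break point the curve passes from one sector to another one: otherwise the arcs on both
sides would end in the only other break point of the sector, which would leave room for no more
than two break points. -/
lemma crossing (hS : SectorSystem Γ W Φ S M) (hγ : IsClosedCurve Γ γ) {u : ℝ} (hu : γ u ∈ W) :
    ∃ i j, i ≠ j ∧ (∃ c < u, ∀ y ∈ Icc c u, γ y ∈ S i) ∧ ∃ d > u, ∀ y ∈ Icc u d, γ y ∈ S j := by
  obtain ⟨c, hc, hcW, hgapc⟩ := hγ.exists_break_lt hS.finite hS.subset hS.nonempty u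
  obtain ⟨d, hd, hdW, hgapd⟩ := hγ.exists_break_gt hS.finite hS.subset hS.nonempty u
  obtain ⟨i, hi⟩ := hS.exists_sector hγ hc hgapc
  obtain ⟨j, hj⟩ := hS.exists_sector hγ hd hgapd
  refine ⟨i, j, ?_, ⟨c, hc, hi⟩, d, hd, hj⟩
  rintro rfl
  -- Otherwise `[c, d]` covers a period, and `γ c`, `γ u` are the only break points.
  have hlen : d - c < 1 := by
    by_contra! hlen
    have hsub : W ⊆ {γ c, γ u} := by
      intro w hw
      obtain ⟨x, hx, rfl⟩ := hγ.exists_mem_Ico (hS.subset hw) c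
      rcases hx.1.eq_or_lt with h | h
      · exact Or.inl (by rw [h])
      rcases lt_trichotomy x u with h' | h' | h'
      · exact absurd hw (hgapc x ⟨h, h'⟩)
      · exact Or.inr (by rw [h']; rfl)
      · exact absurd hw (hgapd x ⟨h', by linarith [hx.2]⟩)
    have h1 := ncard_le_ncard hsub
    have h2 := ncard_insert_le (γ c) {γ u}
    rw [ncard_singleton] at h2
    have := hS.three
    omega
  have hcu : γ c ≠ γ u := fun h => by linarith [hγ.one_le_sub hc h]
  have hud : γ u ≠ γ d := fun h => by linarith [hγ.one_le_sub hd h]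
  have hcd : γ c ≠ γ d := fun h => by linarith [hγ.one_le_sub (hc.trans hd) h]
  have hsub : {γ c, γ u, γ d} ⊆ W ∩ S i := by
    rintro z (rfl | rfl | rfl)
    · exact ⟨hcW, hi c ⟨le_rfl, hc.le⟩⟩
    · exact ⟨hu, hi u ⟨hc.le, le_rfl⟩⟩
    · exact ⟨hdW, hj d ⟨hd.le, le_rfl⟩⟩
  have h1 := ncard_le_ncard hsub (hS.finite.inter_of_left _)
  rw [ncard_eq_three.2 ⟨_, _, _, hcu, hcd, hud, rfl⟩] at h1
  have := hS.two i
  omega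

lemma exists_sector_nhds (hS : SectorSystem Γ W Φ S M) (hγ : IsClosedCurve Γ γ) {x : ℝ}
    (hx : γ x ∉ W) : ∃ i, ∀ᶠ y in 𝓝 x, γ y ∈ S i := by
  obtain ⟨i, c, hc, hi⟩ := hS.exists_left_sector hγ x
  obtain ⟨j, d, hd, hj⟩ := hS.exists_right_sector hγ x
  obtain rfl : i = j := by
    by_contra hij
    exact hx (hS.inter i j hij _ (hγ.mem x) (hi x ⟨hc.le, le_rfl⟩) (hj x ⟨le_rfl, hd.le⟩))
  refine ⟨i, ?_⟩
  filter_upwards [Icc_mem_nhds hc hd] with y hy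
  rcases le_total y x with h | h
  · exact hi y ⟨hy.1, h⟩
  · exact hj y ⟨h, hy.2⟩

/-- The map preserves straightness at points which are not break points. -/
lemma flatAt_iff (hS : SectorSystem Γ W Φ S M) (hγ : IsClosedCurve Γ γ) {f : ℝ ≃o ℝ}
    (hf : ∀ x, Φ (γ x) = γ (f x)) {x : ℝ} (hx : γ x ∉ W) : FlatAt γ (f x) ↔ FlatAt γ x := by
  obtain ⟨i, hi⟩ := hS.exists_sector_nhds hγ hx
  have hxi := hi.self_of_nhds
  have key : ∀ y z, γ y ∈ S i → γ z ∈ S i →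
      area (γ (f y) - γ (f x)) (γ (f z) - γ (f x)) = area (γ y - γ x) (γ z - γ x) := by
    intro y z hy hz
    rw [← hf, ← hf, ← hf, hS.map_sub i _ hy _ hxi, hS.map_sub i _ hz _ hxi, hS.area_map]
  have hi2 : ∀ᶠ q : ℝ × ℝ in 𝓝 (x, x), γ q.1 ∈ S i ∧ γ q.2 ∈ S i := by
    rw [nhds_prod_eq]
    exact hi.prod_mk hi
  constructor
  · intro h
    have ht : Tendsto (fun q : ℝ × ℝ => (f q.1, f q.2)) (𝓝 (x, x)) (𝓝 (f x, f x)) :=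
      Continuous.tendsto (f := fun q : ℝ × ℝ => (f q.1, f q.2))
        ((f.continuous.comp continuous_fst).prodMk (f.continuous.comp continuous_snd)) (x, x)
    filter_upwards [ht.eventually h, hi2] with q hq hqi
    rwa [← key _ _ hqi.1 hqi.2]
  · intro h
    have ht : Tendsto (fun q : ℝ × ℝ => (f.symm q.1, f.symm q.2)) (𝓝 (f x, f x)) (𝓝 (x, x)) := by
      have := Continuous.tendsto (f := fun q : ℝ × ℝ => (f.symm q.1, f.symm q.2))
        ((f.symm.continuous.comp continuous_fst).prodMk (f.symm.continuous.comp continuous_snd))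
        (f x, f x)
      simpa using this
    filter_upwards [ht.eventually h, ht.eventually hi2] with q hq hqi
    have := key _ _ hqi.1 hqi.2
    rw [f.apply_symm_apply, f.apply_symm_apply] at this
    rwa [this]

/-- An iterate of the map is affine on a sufficiently short arc to the left of any given point, even
of a break point. -/
lemma exists_left_affine (hS : SectorSystem Γ W Φ S M) (hγ : IsClosedCurve Γ γ) {f : ℝ → ℝ}
    (hm : Monotone f) (hc : Continuous f) (hf : ∀ x, Φ (γ x) = γ (f x)) (k : ℕ) (x : ℝ) :
    ∃ T : Plane →ₗ[ℝ] Plane, (∀ v w, area (T v) (T w) = area v w) ∧ ∃ c < x, ∀ y ∈ Icc c x,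
      γ (f^[k] y) - γ (f^[k] x) = T (γ y - γ x) := by
  induction k with
  | zero => exact ⟨LinearMap.id, fun _ _ => rfl, x - 1, by linarith, fun _ _ => rfl⟩
  | succ k ih =>
    obtain ⟨T, hT, c, hcx, hcT⟩ := ih
    obtain ⟨i, a, ha, hi⟩ := hS.exists_left_sector hγ (f^[k] x)
    have hnear : ∀ᶠ y in 𝓝[<] x, a < f^[k] y ∧ c < y ∧ y < x :=
      (((hc.iterate k).tendsto x).mono_left nhdsWithin_le_nhds |>.eventually (lt_mem_nhds ha)).and
        (Ioo_mem_nhdsLT hcx)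
    obtain ⟨c', hc'a, hcc', hc'x⟩ := hnear.exists
    refine ⟨M i ∘ₗ T, fun v w => by simp [hS.area_map, hT], c', hc'x, fun y hy => ?_⟩
    have hmem : ∀ y ∈ Icc c' x, γ (f^[k] y) ∈ S i := fun y hy =>
      hi _ ⟨hc'a.le.trans (hm.iterate k hy.1), hm.iterate k hy.2⟩
    rw [Function.iterate_succ_apply', Function.iterate_succ_apply', ← hf, ← hf,
      hS.map_sub i _ (hmem y hy) _ (hmem x ⟨hc'x.le, le_rfl⟩), hcT y ⟨hcc'.le.trans hy.1, hy.2⟩]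
    rfl

lemma exists_right_affine (hS : SectorSystem Γ W Φ S M) (hγ : IsClosedCurve Γ γ) {f : ℝ → ℝ}
    (hm : Monotone f) (hc : Continuous f) (hf : ∀ x, Φ (γ x) = γ (f x)) (k : ℕ) (x : ℝ) :
    ∃ T : Plane →ₗ[ℝ] Plane, (∀ v w, area (T v) (T w) = area v w) ∧ ∃ d > x, ∀ y ∈ Icc x d,
      γ (f^[k] y) - γ (f^[k] x) = T (γ y - γ x) := by
  obtain ⟨T, hT, c, hcx, hcT⟩ := hS.exists_left_affine hγ.neg (f := fun x => -f (-x))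
    (fun x y hxy => neg_le_neg (hm (neg_le_neg hxy))) (by fun_prop) (by simpa using fun x => hf (-x))
    k (-x)
  refine ⟨T, hT, -c, by linarith, fun y hy => ?_⟩
  simpa only [iterate_neg_conj, neg_neg] using hcT (-y) ⟨by linarith [hy.2], by linarith [hy.1]⟩

end SectorSystem

/-! ### Orbits of corner points return to break points -/

/-- At the point `X` the map of a sector system has a genuine corner: `X` lies in the sectors `S i`
and `S j` only, these are separated by the line through `X` with direction `e`, which meets the
curve `Γ` inside them at `X` only, and the linear parts `M i` and `M j` agree on `e` but differ by a
nontrivial shear, whose size is recorded by `c`. -/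
structure IsCorner (Γ : Set Plane) {ι : Type*} (S : ι → Set Plane) (M : ι → Plane →ₗ[ℝ] Plane)
    (X : Plane) (i j : ι) (e : Plane) (c : ℝ) : Prop where
  only : ∀ k, X ∈ S k → k = i ∨ k = j
  map_eq : M i e = M j e
  ne_zero : c ≠ 0
  jump : ∀ v, area (M i v) (M j v) = c * area e v ^ 2
  transversal : ∀ z ∈ Γ, z ∈ S i ∨ z ∈ S j → area e (z - X) = 0 → z = X

lemma map_add_int_of_map_add_one {f : ℝ → ℝ} (hf : ∀ x, f (x + 1) = f x + 1) (x : ℝ) (n : ℤ) :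
    f (x + n) = f x + n := by
  have hp : Function.Periodic (fun x => f x - x) 1 := fun x => by simp only [hf]; ring
  have := hp.int_mul n x
  simp only [mul_one] at this
  linarith

lemma iterate_map_add_one {f : ℝ → ℝ} (hf : ∀ x, f (x + 1) = f x + 1) (n : ℕ) (x : ℝ) :
    f^[n] (x + 1) = f^[n] x + 1 :=
  (Function.Commute.iterate_left (f := f) (g := (· + 1)) hf n) x

namespace SectorSystem

variable {Γ W : Set Plane} {γ : ℝ → Plane} {Φ : Plane → Plane} {ι : Type*} [Finite ι]
  {S : ι → Set Plane} {M : ι → Plane →ₗ[ℝ] Plane} {X e : Plane} {i j : ι} {c : ℝ}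

/-- The indices of the two sectors at a corner can be chosen such that the curve passes from the first
sector to the second. -/
lemma crossing_corner (hS : SectorSystem Γ W Φ S M) (hγ : IsClosedCurve Γ γ) {u : ℝ}
    (hu : γ u ∈ W) (hX : IsCorner Γ S M (γ u) i j e c) :
    ∃ i j c, IsCorner Γ S M (γ u) i j e c ∧ (∃ a < u, ∀ y ∈ Icc a u, γ y ∈ S i) ∧
      ∃ d > u, ∀ y ∈ Icc u d, γ y ∈ S j := by
  obtain ⟨k, l, hkl, ⟨a, ha, hk⟩, d, hd, hl⟩ := hS.crossing hγ hu
  have h1 := hX.only k (hk u ⟨ha.le, le_rfl⟩)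
  have h2 := hX.only l (hl u ⟨le_rfl, hd.le⟩)
  rcases h1 with rfl | rfl
  · obtain rfl : l = j := h2.resolve_left hkl.symm
    exact ⟨k, l, c, hX, ⟨a, ha, hk⟩, d, hd, hl⟩
  · obtain rfl : l = i := h2.resolve_right hkl.symm
    refine ⟨k, l, -c, ⟨fun m hm => (hX.only m hm).symm, hX.map_eq.symm, neg_ne_zero.2 hX.ne_zero,
      fun v => ?_, fun z hz h => hX.transversal z hz h.symm⟩, ⟨a, ha, hk⟩, d, hd, hl⟩
    rw [area_swap, hX.jump]
    ring

/-- A curve which is straight at a corner of the map has a corner at the image point. -/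
lemma not_flatAt_map (hS : SectorSystem Γ W Φ S M) (hγ : IsClosedCurve Γ γ) {f : ℝ ≃o ℝ}
    (hf : ∀ x, Φ (γ x) = γ (f x)) {u : ℝ} (hu : γ u ∈ W) (hX : IsCorner Γ S M (γ u) i j e c)
    (h0 : FlatAt γ u) (h1 : FlatAt γ (f u)) : False := by
  obtain ⟨i, j, c, hX, ⟨a, ha, hi⟩, d, hd, hj⟩ := hS.crossing_corner hγ hu hX
  have ht : Tendsto (fun q : ℝ × ℝ => (f q.1, f q.2)) (𝓝 (u, u)) (𝓝 (f u, f u)) :=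
    Continuous.tendsto (f := fun q : ℝ × ℝ => (f q.1, f q.2))
      ((f.continuous.comp continuous_fst).prodMk (f.continuous.comp continuous_snd)) (u, u)
  have hflat := h0.and (ht.eventually h1)
  rw [nhds_prod_eq] at hflat
  have hlr : 𝓝[<] u ×ˢ 𝓝[>] u ≤ 𝓝 u ×ˢ 𝓝 u :=
    prod_mono nhdsWithin_le_nhds nhdsWithin_le_nhds
  obtain ⟨⟨x, y⟩, ⟨hxy0, hxy1⟩, hx, hy⟩ := ((hflat.filter_mono hlr).and
    (prod_mem_prod (Ioo_mem_nhdsLT (max_lt ha (sub_one_lt u)))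
      (Ioo_mem_nhdsGT (lt_min hd (lt_add_one u))))).exists
  simp only at hx hy hxy0 hxy1
  have hxa := (max_lt_iff.1 hx.1)
  have hyd := (lt_min_iff.1 hy.2)
  have hxi := hi x ⟨hxa.1.le, hx.2.le⟩
  have hyj := hj y ⟨hy.1.le, hyd.1.le⟩
  have hui := hi u ⟨ha.le, le_rfl⟩
  have huj := hj u ⟨le_rfl, hd.le⟩
  have hex : area e (γ x - γ u) ≠ 0 := fun h => by
    have := hγ.one_le_sub hx.2 (hX.transversal _ (hγ.mem x) (Or.inl hxi) h)
    linarith [hxa.2]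
  have hey : area e (γ y - γ u) ≠ 0 := fun h => by
    have := hγ.one_le_sub hy.1 (hX.transversal _ (hγ.mem y) (Or.inr hyj) h).symm
    linarith [hyd.2]
  rw [← hf, ← hf, ← hf, hS.map_sub i _ hxi _ hui, hS.map_sub j _ hyj _ huj] at hxy1
  generalize γ x - γ u = v at *
  generalize γ y - γ u = w at *
  have hv : v ≠ 0 := by
    rintro rfl
    simp [area] at hex
  obtain ⟨r, rfl⟩ := exists_smul_of_area_eq_zero hv hxy0
  rw [map_smul, area_smul_right, hX.jump] at hxy1
  rw [area_smul_right] at hey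
  have hr : r ≠ 0 := left_ne_zero_of_mul hey
  exact mul_ne_zero hr (mul_ne_zero hX.ne_zero (pow_ne_zero 2 hex)) hxy1

/-- If the rotation number is rational, the orbit of a corner point returns to a break point: the
curve is straight near all points of the orbit in the far past and in the far future, hence straight
before the corner and straight after it. -/
theorem exists_return (hS : SectorSystem Γ W Φ S M) (hγ : IsClosedCurve Γ γ) {f : ℝ ≃o ℝ}
    (hf : ∀ x, Φ (γ x) = γ (f x)) (hf1 : ∀ x, f (x + 1) = f x + 1) {q : ℕ} (hq : 0 < q) {m : ℤ}
    {x₀ : ℝ} (hx₀ : f^[q] x₀ = x₀ + m) {u : ℝ} (hu : γ u ∈ W)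
    (hX : IsCorner Γ S M (γ u) i j e c) :
    ∃ k, 0 < k ∧ (γ (f^[k] u) ∈ W ∨ γ (f.symm^[k] u) ∈ W) := by
  by_contra! hW
  have hfm : StrictMono f^[q] := f.strictMono.iterate q
  have hfc : Continuous f^[q] := f.continuous.iterate q
  have hgm : StrictMono f.symm^[q] := f.symm.strictMono.iterate q
  have hgc : Continuous f.symm^[q] := f.symm.continuous.iterate q
  have hg1 : ∀ x, f.symm (x + 1) = f.symm x + 1 := fun x => by
    rw [f.symm_apply_eq, hf1, f.apply_symm_apply]
  have hfi := map_add_int_of_map_add_one (iterate_map_add_one hf1 q)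
  have hgi := map_add_int_of_map_add_one (iterate_map_add_one hg1 q)
  have hfg : ∀ x, f^[q] (f.symm^[q] x) = x := Function.LeftInverse.iterate f.apply_symm_apply q
  have hgf : ∀ x, f.symm^[q] (f^[q] x) = x := Function.LeftInverse.iterate f.symm_apply_apply q
  set h : ℝ → ℝ := fun x => f^[q] x - m with hh
  set g : ℝ → ℝ := fun x => f.symm^[q] x + m with hg
  have hhg : ∀ x, h (g x) = x := fun x => by simp only [hh, hg, hfi, hfg]; ring
  have hgh : ∀ x, g (h x) = x := fun x => by
    have := hgi (f^[q] x) (-m)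
    simp only [hh, hg, sub_eq_add_neg] at this ⊢
    push_cast at this
    rw [this, hgf]
    ring
  have hhm : StrictMono h := fun x y hxy => sub_lt_sub_right (hfm hxy) _
  have hgm' : StrictMono g := fun x y hxy => by simpa [hg] using hgm hxy
  have hγh : ∀ x, γ (h x) = γ (f^[q] x) := fun x => by
    have := hγ.add_int (f^[q] x) (-m)
    push_cast at this
    rwa [← sub_eq_add_neg] at this
  -- The integer translates of `x₀` are fixed points on both sides of `u`.
  have hfix : ∀ k : ℤ, h (x₀ + k) = x₀ + k := fun k => by simp only [hh, hfi, hx₀]; ring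
  have hfixg : ∀ x, h x = x ↔ g x = x := fun x =>
    ⟨fun e => by rw [← e, hgh, e], fun e => by rw [← e, hhg, e]⟩
  have hpu : x₀ + (⌊u - x₀⌋ - 1 : ℤ) < u := by push_cast; linarith [Int.floor_le (u - x₀)]
  have hup : u < x₀ + (⌊u - x₀⌋ + 1 : ℤ) := by push_cast; linarith [Int.lt_floor_add_one (u - x₀)]
  have hmove : h u ≠ u := fun e => (hW q hq).1 (by rwa [← hγh, e])
  have hleft : ∀ b, h b = b → ∃ a < b, ∀ x ∈ Ioo a b, ∀ y ∈ Ioo a b,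
      area (γ (h x) - γ b) (γ (h y) - γ b) = area (γ x - γ b) (γ y - γ b) := by
    intro b hb
    obtain ⟨T, hT, a, ha, haT⟩ := hS.exists_left_affine hγ f.monotone f.continuous hf q b
    refine ⟨a, ha, fun x hx y hy => ?_⟩
    have e : γ (f^[q] b) = γ b := by rw [← hγh, hb]
    have e1 := haT x ⟨hx.1.le, hx.2.le⟩
    have e2 := haT y ⟨hy.1.le, hy.2.le⟩
    rw [e] at e1 e2
    rw [hγh, hγh, e1, e2, hT]
  have hright : ∀ b, h b = b → ∃ a > b, ∀ x ∈ Ioo b a, ∀ y ∈ Ioo b a,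
      area (γ (h x) - γ b) (γ (h y) - γ b) = area (γ x - γ b) (γ y - γ b) := by
    intro b hb
    obtain ⟨T, hT, a, ha, haT⟩ := hS.exists_right_affine hγ f.monotone f.continuous hf q b
    refine ⟨a, ha, fun x hx y hy => ?_⟩
    have e : γ (f^[q] b) = γ b := by rw [← hγh, hb]
    have e1 := haT x ⟨hx.1.le, hx.2.le⟩
    have e2 := haT y ⟨hy.1.le, hy.2.le⟩
    rw [e] at e1 e2
    rw [hγh, hγh, e1, e2, hT]
  obtain ⟨N, hN⟩ := flatAt_iterate hγ.continuous hhm (by fun_prop) hmove hpu hup (hfix _) (hfix _)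
    hleft hright
  obtain ⟨N', hN'⟩ := flatAt_iterate hγ.continuous hgm' (by fun_prop)
    (fun e => hmove ((hfixg u).2 e)) hpu hup ((hfixg _).1 (hfix _)) ((hfixg _).1 (hfix _))
    (by
      intro b hb
      obtain ⟨a, ha, haT⟩ := hleft b ((hfixg b).2 hb)
      have hmem : ∀ x ∈ Ioo (h a) b, g x ∈ Ioo a b := fun x hx =>
        ⟨by simpa only [hgh] using hgm' hx.1, by simpa only [hb] using hgm' hx.2⟩
      refine ⟨h a, by simpa only [(hfixg b).2 hb] using hhm ha, fun x hx y hy => ?_⟩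
      rw [← haT _ (hmem x hx) _ (hmem y hy), hhg, hhg])
    (by
      intro b hb
      obtain ⟨a, ha, haT⟩ := hright b ((hfixg b).2 hb)
      have hmem : ∀ x ∈ Ioo b (h a), g x ∈ Ioo b a := fun x hx =>
        ⟨by simpa only [hb] using hgm' hx.1, by simpa only [hgh] using hgm' hx.2⟩
      refine ⟨h a, by simpa only [(hfixg b).2 hb] using hhm ha, fun x hx y hy => ?_⟩
      rw [← haT _ (hmem x hx) _ (hmem y hy), hhg, hhg])
  have hith : ∀ n, ∃ k : ℤ, h^[n] u = f^[q * n] u + k := by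
    intro n
    induction n with
    | zero => exact ⟨0, by simp⟩
    | succ n ih =>
      obtain ⟨k, hk⟩ := ih
      refine ⟨k - m, ?_⟩
      rw [Function.iterate_succ_apply', hk, Nat.mul_succ, add_comm (q * n),
        Function.iterate_add_apply]
      simp only [hh, hfi]
      push_cast; ring
  have hitg : ∀ n, ∃ k : ℤ, g^[n] u = f.symm^[q * n] u + k := by
    intro n
    induction n with
    | zero => exact ⟨0, by simp⟩
    | succ n ih =>
      obtain ⟨k, hk⟩ := ih
      refine ⟨k + m, ?_⟩
      rw [Function.iterate_succ_apply', hk, Nat.mul_succ, add_comm (q * n),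
        Function.iterate_add_apply]
      simp only [hg, hgi]
      push_cast; ring
  have hforward : ∀ k, FlatAt γ (f^[k + 1] u) → FlatAt γ (f u) := by
    intro k
    induction k with
    | zero => exact id
    | succ k ih =>
      intro hk
      rw [Function.iterate_succ_apply', hS.flatAt_iff hγ hf (hW _ k.succ_pos).1] at hk
      exact ih hk
  have hback : ∀ k, FlatAt γ (f.symm^[k] u) → FlatAt γ u := by
    intro k
    induction k with
    | zero => exact id
    | succ k ih =>
      intro hk
      rw [← hS.flatAt_iff hγ hf (hW _ k.succ_pos).2, Function.iterate_succ_apply',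
        f.apply_symm_apply] at hk
      exact ih hk
  obtain ⟨k, hk⟩ := hith (N + 1)
  obtain ⟨k', hk'⟩ := hitg N'
  have h1 := hN (N + 1) (Nat.le_succ N)
  have h2 := hN' N' le_rfl
  rw [hk] at h1
  rw [hk'] at h2
  have h3 := h1.add_int hγ.periodic
  obtain ⟨r, hr⟩ : ∃ r, q * (N + 1) = r + 1 := ⟨q * (N + 1) - 1, by
    have : 0 < q * (N + 1) := by positivity
    omega⟩
  rw [hr] at h3
  exact hS.not_flatAt_map hγ hf hu hX (hback _ (h2.add_int hγ.periodic)) (hforward r h3)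

end SectorSystem

/-! ### Periodic break points -/

/-- Two area-preserving linear maps which differ by a nontrivial shear along `e` cannot both have
the eigenvalue `1` with eigenvectors transversal to `e`. -/
lemma not_fixed_both_sides {L L' : Plane →ₗ[ℝ] Plane} (hL : ∀ v w, area (L v) (L w) = area v w)
    (hL' : ∀ v w, area (L' v) (L' w) = area v w) {e : Plane} {c : ℝ} (he : L e = L' e) (hc : c ≠ 0)
    (hjump : ∀ v, area (L v) (L' v) = c * area e v ^ 2) {w w' : Plane} (hw : L w = w)
    (hw' : L' w' = w') (hew : area e w ≠ 0) (hew' : area e w' ≠ 0) : False := by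
  have hw0 : w ≠ 0 := by rintro rfl; simp [area] at hew
  have hw0' : w' ≠ 0 := by rintro rfl; simp [area] at hew'
  have hj := hjump w
  have hj' := hjump w'
  rw [hw] at hj
  rw [hw'] at hj'
  by_cases hD : area w w' = 0
  · obtain ⟨r, rfl⟩ := exists_smul_of_area_eq_zero hw0 hD
    rw [map_smul, hw, area_self] at hj'
    exact mul_ne_zero hc (pow_ne_zero 2 hew') hj'.symm
  -- `L` shears `w'` along `w` and `L'` shears `w` along `w'`.
  have h1 : area w (L w' - w') = 0 := by
    have := hL w w'
    rw [hw] at this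
    simp only [area, Prod.fst_sub, Prod.snd_sub] at this ⊢
    linarith
  have h2 : area w' (L' w - w) = 0 := by
    have := hL' w' w
    rw [hw'] at this
    simp only [area, Prod.fst_sub, Prod.snd_sub] at this ⊢
    linarith
  obtain ⟨k, hk⟩ := exists_smul_of_area_eq_zero hw0 h1
  obtain ⟨k', hk'⟩ := exists_smul_of_area_eq_zero hw0' h2
  rw [sub_eq_iff_eq_add] at hk hk'
  have hk0 : k' ≠ 0 := by
    rintro rfl
    rw [hk', zero_smul, zero_add, area_self] at hj
    exact mul_ne_zero hc (pow_ne_zero 2 hew) hj.symm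
  have hdec : area w w' • e = area e w' • w + area w e • w' := by
    ext <;> simp [area] <;> ring
  have hLe : area w w' • L e = area e w' • w + area w e • (k • w + w') := by
    rw [← map_smul, hdec, map_add, map_smul, map_smul, hw, hk]
  have hLe' : area w w' • L' e = area e w' • (k' • w' + w) + area w e • w' := by
    rw [← map_smul, hdec, map_add, map_smul, map_smul, hw', hk']
  rw [he, hLe'] at hLe
  have := congrArg (area w) hLe
  have h0 : area e w' * k' * area w w' = 0 := by
    simp only [area, Prod.fst_add, Prod.snd_add, Prod.smul_fst, Prod.smul_snd, smul_eq_mul]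
      at this ⊢
    linarith
  exact mul_ne_zero (mul_ne_zero hew' hk0) hD h0

/-- Orbits of an increasing map which are confined between fixed points are monotone, hence converge
to fixed points. -/
lemma exists_tendsto_iterate {h : ℝ → ℝ} (hm : StrictMono h) (hc : Continuous h) {a b y : ℝ}
    (ha : h a = a) (hb : h b = b) (hy : y ∈ Icc a b) :
    ∃ p ∈ Icc a b, h p = p ∧ Tendsto (fun n => h^[n] y) atTop (𝓝 p) := by
  have hmem : ∀ n, h^[n] y ∈ Icc a b := fun n => by
    have h1 := (hm.iterate n).monotone hy.1
    have h2 := (hm.iterate n).monotone hy.2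
    rw [Function.iterate_fixed ha] at h1
    rw [Function.iterate_fixed hb] at h2
    exact ⟨h1, h2⟩
  obtain ⟨p, hp⟩ : ∃ p, Tendsto (fun n => h^[n] y) atTop (𝓝 p) := by
    rcases le_total y (h y) with h1 | h1
    · exact ⟨_, tendsto_atTop_ciSup (hm.monotone.monotone_iterate_of_le_map h1)
        ⟨b, by rintro _ ⟨n, rfl⟩; exact (hmem n).2⟩⟩
    · exact ⟨_, tendsto_atTop_ciInf (hm.monotone.antitone_iterate_of_map_le h1)
        ⟨a, by rintro _ ⟨n, rfl⟩; exact (hmem n).1⟩⟩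
  exact ⟨p, isClosed_Icc.mem_of_tendsto hp (Eventually.of_forall hmem),
    isFixedPt_of_tendsto_iterate hp hc.continuousAt, hp⟩

/-- Around a point which is not fixed, and which lies between fixed points, there is a gap of the
set of fixed points. -/
lemma exists_gap_of_fixed {h : ℝ → ℝ} (hc : Continuous h) {x p p' : ℝ} (hx : h x ≠ x) (hpx : p ≤ x)
    (hxp : x ≤ p') (hp : h p = p) (hp' : h p' = p') :
    ∃ a b, x ∈ Ioo a b ∧ h a = a ∧ h b = b ∧ ∀ y ∈ Ioo a b, h y ≠ y := by
  have hcl : IsClosed {z | h z = z} := isClosed_eq hc continuous_id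
  have hA := (hcl.inter (isClosed_Iic (a := x))).csSup_mem ⟨p, hp, hpx⟩ ⟨x, fun z hz => hz.2⟩
  have hB := (hcl.inter (isClosed_Ici (a := x))).csInf_mem ⟨p', hp', hxp⟩ ⟨x, fun z hz => hz.2⟩
  refine ⟨sSup ({z | h z = z} ∩ Iic x), sInf ({z | h z = z} ∩ Ici x), ⟨?_, ?_⟩, hA.1, hB.1, ?_⟩
  · exact lt_of_le_of_ne hA.2 fun e => hx (e ▸ hA.1)
  · exact lt_of_le_of_ne hB.2 fun e => hx (e.symm ▸ hB.1)
  · intro y hy hfix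
    rcases le_total y x with h1 | h1
    · exact not_le.2 hy.1 (le_csSup (s := {z | h z = z} ∩ Iic x) ⟨x, fun z hz => hz.2⟩ ⟨hfix, h1⟩)
    · exact not_le.2 hy.2 (csInf_le (s := {z | h z = z} ∩ Ici x) ⟨x, fun z hz => hz.2⟩ ⟨hfix, h1⟩)

lemma exists_linear_iterate {R : Plane → Plane} {T : Plane →ₗ[ℝ] Plane}
    (hT : ∀ v w, area (T v) (T w) = area v w) (hR : ∀ z w, R z - R w = T (z - w)) (n : ℕ) :
    ∃ T' : Plane →ₗ[ℝ] Plane, (∀ v w, area (T' v) (T' w) = area v w) ∧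
      ∀ z w, R^[n] z - R^[n] w = T' (z - w) := by
  induction n with
  | zero => exact ⟨LinearMap.id, fun _ _ => rfl, fun _ _ => rfl⟩
  | succ n ih =>
    obtain ⟨T', h1, h2⟩ := ih
    refine ⟨T ∘ₗ T', fun v w => by simp [hT, h1], fun z w => ?_⟩
    rw [Function.iterate_succ_apply', Function.iterate_succ_apply', hR, h2]
    rfl

lemma semiconj_iterate {γ : ℝ → Plane} {Φ : Plane → Plane} {f : ℝ → ℝ}
    (hf : ∀ x, Φ (γ x) = γ (f x)) (n : ℕ) (x : ℝ) : Φ^[n] (γ x) = γ (f^[n] x) :=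
  ((Function.Semiconj.iterate_right (f := γ) (ga := f) (gb := Φ) (fun x => (hf x).symm) n) x).symm

namespace SectorSystem

variable {Γ W : Set Plane} {γ : ℝ → Plane} {Φ : Plane → Plane} {ι : Type*} [Finite ι]
  {S : ι → Set Plane} {M : ι → Plane →ₗ[ℝ] Plane} {X e : Plane} {i j : ι} {c : ℝ}

lemma exists_affine_nhds (hS : SectorSystem Γ W Φ S M) (hγ : IsClosedCurve Γ γ) {f : ℝ → ℝ}
    (hc : Continuous f) (hf : ∀ x, Φ (γ x) = γ (f x)) {k : ℕ} {x : ℝ}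
    (hx : ∀ n < k, γ (f^[n] x) ∉ W) :
    ∃ T : Plane →ₗ[ℝ] Plane, (∀ v w, area (T v) (T w) = area v w) ∧ ∀ᶠ y in 𝓝 x,
      γ (f^[k] y) - γ (f^[k] x) = T (γ y - γ x) := by
  induction k with
  | zero => exact ⟨LinearMap.id, fun _ _ => rfl, Eventually.of_forall fun _ => rfl⟩
  | succ k ih =>
    obtain ⟨T, hT, hTy⟩ := ih fun n hn => hx n (hn.trans k.lt_succ_self)
    obtain ⟨i, hi⟩ := hS.exists_sector_nhds hγ (hx k k.lt_succ_self)
    refine ⟨M i ∘ₗ T, fun v w => by simp [hS.area_map, hT], ?_⟩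
    filter_upwards [hTy, ((hc.iterate k).tendsto x).eventually hi] with y hy hyi
    rw [Function.iterate_succ_apply', Function.iterate_succ_apply', ← hf, ← hf,
      hS.map_sub i _ hyi _ hi.self_of_nhds, hy]
    rfl

lemma exists_affine_Icc (hS : SectorSystem Γ W Φ S M) (hγ : IsClosedCurve Γ γ) {f : ℝ ≃o ℝ}
    (hf : ∀ x, Φ (γ x) = γ (f x)) {k : ℕ} {a b : ℝ} (hab : a < b)
    (hW : ∀ n < k, ∀ y ∈ Ioo a b, γ (f^[n] y) ∉ W) :
    ∃ T : Plane →ₗ[ℝ] Plane, (∀ v w, area (T v) (T w) = area v w) ∧ ∀ y ∈ Icc a b, ∀ z ∈ Icc a b,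
      γ (f^[k] y) - γ (f^[k] z) = T (γ y - γ z) := by
  induction k with
  | zero => exact ⟨LinearMap.id, fun _ _ => rfl, fun _ _ _ _ => rfl⟩
  | succ k ih =>
    obtain ⟨T, hT, hTy⟩ := ih fun n hn => hW n (hn.trans k.lt_succ_self)
    have hmono : StrictMono f^[k] := f.strictMono.iterate k
    have hfg : ∀ x, f^[k] (f.symm^[k] x) = x := Function.LeftInverse.iterate f.apply_symm_apply k
    obtain ⟨i, hi⟩ := hS.exists_sector hγ (hmono hab) (by
      intro y hy
      have := hW k k.lt_succ_self (f.symm^[k] y)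
        ⟨hmono.lt_iff_lt.1 (by rw [hfg]; exact hy.1), hmono.lt_iff_lt.1 (by rw [hfg]; exact hy.2)⟩
      rwa [hfg] at this)
    have hmem : ∀ y ∈ Icc a b, γ (f^[k] y) ∈ S i := fun y hy =>
      hi _ ⟨hmono.monotone hy.1, hmono.monotone hy.2⟩
    refine ⟨M i ∘ₗ T, fun v w => by simp [hS.area_map, hT], fun y hy z hz => ?_⟩
    rw [Function.iterate_succ_apply', Function.iterate_succ_apply', ← hf, ← hf,
      hS.map_sub i _ (hmem y hy) _ (hmem z hz), hTy y hy z hz]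
    rfl

/-- If all break points are periodic, then so are all points of the curve: in a gap between fixed
points of a suitable iterate, this iterate is affine, so the area of the triangle formed by a point
and the ends of the gap is preserved, while it tends to zero. Hence the arc is a segment, with fixed
end points. -/
theorem iterate_eq_self (hS : SectorSystem Γ W Φ S M) (hγ : IsClosedCurve Γ γ) {f : ℝ ≃o ℝ}
    (hf : ∀ x, Φ (γ x) = γ (f x)) (hf1 : ∀ x, f (x + 1) = f x + 1) {N : ℕ}
    (hN : ∀ w ∈ W, Φ^[N] w = w) {z : Plane} (hz : z ∈ Γ) : Φ^[N] z = z := by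
  obtain ⟨w, hw⟩ := hS.nonempty
  obtain ⟨u, -, rfl⟩ := hγ.exists_mem_Ico (hS.subset hw) 0
  have hlift : ∀ k x, Φ^[k] (γ x) = γ (f^[k] x) := semiconj_iterate hf
  have hfm : StrictMono f^[N] := f.strictMono.iterate N
  have hfc : Continuous f^[N] := f.continuous.iterate N
  have hfi := map_add_int_of_map_add_one (iterate_map_add_one hf1 N)
  obtain ⟨m, hm⟩ := hγ.injective u (f^[N] u) (by rw [← hlift, hN _ hw])
  set h : ℝ → ℝ := fun x => f^[N] x - m with hh
  have hhm : StrictMono h := fun x y hxy => sub_lt_sub_right (hfm hxy) _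
  have hhc : Continuous h := by fun_prop
  have hhi : ∀ x (n : ℤ), h (x + n) = h x + n := fun x n => by simp only [hh, hfi]; ring
  have hγh : ∀ x, γ (h x) = Φ^[N] (γ x) := fun x => by
    have := hγ.add_int (f^[N] x) (-m)
    push_cast at this
    rwa [← sub_eq_add_neg, ← hlift] at this
  have hhu : h u = u := by simp only [hh, hm]; ring
  have hhuk : ∀ k : ℤ, h (u + k) = u + k := fun k => by rw [hhi, hhu]
  have hfloor : ∀ y, u + ⌊y - u⌋ ≤ y ∧ y < u + (⌊y - u⌋ + 1 : ℤ) := fun y => by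
    have h1 := Int.floor_le (y - u)
    have h2 := Int.lt_floor_add_one (y - u)
    push_cast
    constructor <;> linarith
  -- All break points have the same displacement as `u`.
  have hbreak : ∀ y, γ y ∈ W → h y = y := by
    intro y hy
    obtain ⟨n, hn⟩ := hγ.injective y (h y) (by rw [hγh, hN _ hy])
    have h1 := hhm.monotone (hfloor y).1
    have h2 := hhm (hfloor y).2
    rw [hhuk] at h1 h2
    have h3 := (hfloor y).1
    have h4 := (hfloor y).2
    push_cast at h2 h4
    have h5 : (n : ℝ) < 1 := by linarith
    have h6 : (-1 : ℝ) < n := by linarith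
    have h7 : n = 0 := by
      have : n < 1 := by exact_mod_cast h5
      have : -1 < n := by exact_mod_cast h6
      omega
    simpa [h7] using hn
  obtain ⟨x, -, rfl⟩ := hγ.exists_mem_Ico hz 0
  rw [← hγh]
  by_contra hx
  obtain ⟨a, b, hxab, ha, hb, hgap⟩ := exists_gap_of_fixed hhc (fun e => hx (by rw [e]))
    (hfloor x).1 (hfloor x).2.le (hhuk _) (hhuk _)
  have hab := hxab.1.trans hxab.2
  have hlen : b - a < 1 := by
    by_contra! hlen
    have hsub : W ⊆ {γ a} := by
      intro w hw
      obtain ⟨y, hy, rfl⟩ := hγ.exists_mem_Ico (hS.subset hw) a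
      rcases hy.1.eq_or_lt with h1 | h1
      · rw [h1]; rfl
      · exact absurd (hbreak y hw) (hgap y ⟨h1, by linarith [hy.2]⟩)
    have h1 := ncard_le_ncard hsub
    rw [ncard_singleton] at h1
    have := hS.three
    omega
  have hγab : γ b - γ a ≠ 0 := fun e => by
    linarith [hγ.one_le_sub hab (sub_eq_zero.1 e).symm]
  obtain ⟨T, hT, hTab⟩ := hS.exists_affine_Icc hγ hf (k := N) hab (by
    intro n _ y hy hyW
    -- `h` commutes with `f`, so it would fix `y` as it fixes the break point `f^[n] y`.
    apply hgap y hy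
    have h1 := hbreak _ hyW
    apply (f.strictMono.iterate n).injective
    have hfn := map_add_int_of_map_add_one (iterate_map_add_one hf1 n) (f^[N] y) (-m)
    push_cast at hfn
    simp only [hh] at h1 ⊢
    rw [sub_eq_add_neg, hfn, ← Function.iterate_add_apply, add_comm n, Function.iterate_add_apply,
      ← sub_eq_add_neg, h1])
  have hTh : ∀ y ∈ Icc a b, γ (h y) - γ a = T (γ y - γ a) := by
    intro y hy
    have := hTab y hy a ⟨le_rfl, hab.le⟩
    rwa [← hlift, ← hlift, ← hγh, ← hγh, ha] at this
  have hTe : T (γ b - γ a) = γ b - γ a := by rw [← hTh b ⟨hab.le, le_rfl⟩, hb]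
  have hmem : ∀ y ∈ Icc a b, h y ∈ Icc a b := fun y hy => by
    have h1 := hhm.monotone hy.1
    have h2 := hhm.monotone hy.2
    rw [ha] at h1
    rw [hb] at h2
    exact ⟨h1, h2⟩
  have hxI : x ∈ Icc a b := ⟨hxab.1.le, hxab.2.le⟩
  obtain ⟨p, hp, hfp, hlim⟩ := exists_tendsto_iterate hhm hhc ha hb hxI
  have hconst : ∀ n, h^[n] x ∈ Icc a b ∧
      area (γ b - γ a) (γ (h^[n] x) - γ a) = area (γ b - γ a) (γ x - γ a) := by
    intro n
    induction n with
    | zero => exact ⟨hxI, rfl⟩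
    | succ n ih =>
      rw [Function.iterate_succ_apply']
      refine ⟨hmem _ ih.1, ?_⟩
      rw [hTh _ ih.1, ← ih.2]
      nth_rewrite 1 [← hTe]
      exact hT _ _
  have harea : area (γ b - γ a) (γ x - γ a) = 0 := by
    have hcont : Continuous fun y => area (γ b - γ a) (γ y - γ a) :=
      continuous_area.comp (continuous_const.prodMk (hγ.continuous.sub continuous_const))
    have h1 := (hcont.tendsto p).comp hlim
    simp only [Function.comp_def, (hconst _).2] at h1
    rw [tendsto_nhds_unique tendsto_const_nhds h1]
    have h2 : p = a ∨ p = b := by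
      rcases hp.1.eq_or_lt with h2 | h2
      · exact Or.inl h2.symm
      rcases hp.2.eq_or_lt with h3 | h3
      · exact Or.inr h3
      · exact absurd hfp (hgap p ⟨h2, h3⟩)
    rcases h2 with rfl | rfl
    · rw [sub_self]; simp [area]
    · exact area_self _
  obtain ⟨r, hr⟩ := exists_smul_of_area_eq_zero hγab harea
  have := hTh x hxI
  rw [hr, map_smul, hTe, ← hr, sub_left_inj] at this
  exact hx this

/-- If all break points are periodic, then no corner point is taken to its image under a symmetry
without visiting a break point in between: composing with the inverse symmetry one gets a map of
finite order of the curve, that is, the identity, while its linear parts on the two sides of the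
corner point differ by a shear. -/
theorem not_return_symm (hS : SectorSystem Γ W Φ S M) (hγ : IsClosedCurve Γ γ) {f : ℝ ≃o ℝ}
    (hf : ∀ x, Φ (γ x) = γ (f x)) (hf1 : ∀ x, f (x + 1) = f x + 1) {N : ℕ} (hN0 : 0 < N)
    (hN : ∀ w ∈ W, Φ^[N] w = w) {R : Plane → Plane} {T : Plane →ₗ[ℝ] Plane}
    (hT : ∀ v w, area (T v) (T w) = area v w) (hR : ∀ z w, R z - R w = T (z - w))
    (hR4 : ∀ z, R^[4] z = z) (hcomm : Function.Commute R Φ) {ρ : ℝ → ℝ} (hρm : StrictMono ρ)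
    (hρc : Continuous ρ) (hρ : ∀ x, R (γ x) = γ (ρ x)) {u : ℝ} (hu : γ u ∈ W)
    (hX : IsCorner Γ S M (γ u) i j e c) {l k : ℕ} (hl : Φ^[l + 1] (γ u) = R^[k] (γ u))
    (hW : ∀ n < l, Φ^[n + 1] (γ u) ∉ W) : False := by
  have hRit : ∀ n z, R^[4 * n] z = z := fun n z => by
    rw [Function.iterate_mul]
    exact Function.iterate_fixed (f := R^[4]) (hR4 z) n
  set g₀ : ℝ → ℝ := fun x => ρ^[3 * k] (f^[l + 1] x) with hg₀
  have hγg₀ : ∀ x, R^[3 * k] (Φ^[l + 1] (γ x)) = γ (g₀ x) := fun x => by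
    rw [semiconj_iterate hf, semiconj_iterate hρ]
  obtain ⟨n, hn⟩ := hγ.injective u (g₀ u) (by
    rw [← hγg₀, hl, ← Function.iterate_add_apply, show 3 * k + k = 4 * k by ring, hRit])
  set g : ℝ → ℝ := fun x => g₀ x - n with hg
  have hgm : StrictMono g := fun x y hxy =>
    sub_lt_sub_right (hρm.iterate _ (f.strictMono.iterate _ hxy)) _
  have hgc : Continuous g :=
    ((hρc.iterate _).comp (f.continuous.iterate _)).sub continuous_const
  have hgu : g u = u := by simp only [hg, hn]; ring
  have hγg : ∀ x, (R^[3 * k] ∘ Φ^[l + 1]) (γ x) = γ (g x) := fun x => by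
    have := hγ.add_int (g₀ x) (-n)
    push_cast at this
    rw [← sub_eq_add_neg] at this
    rw [Function.comp_apply, hγg₀, ← this]
  have hgK : ∀ x, γ (g^[4 * N] x) = γ x := fun x => by
    have hc' : Function.Commute R^[3 * k] Φ^[l + 1] := hcomm.iterate_iterate _ _
    rw [← semiconj_iterate hγg, hc'.comp_iterate, Function.comp_apply, ← Function.iterate_mul,
      ← Function.iterate_mul, show (l + 1) * (4 * N) = N * (4 * (l + 1)) by ring,
      Function.iterate_mul Φ, Function.iterate_fixed (hS.iterate_eq_self hγ hf hf1 hN (hγ.mem x)),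
      show 3 * k * (4 * N) = 4 * (3 * k * N) by ring, hRit]
  -- `g` is increasing, fixes `u` and has finite order near `u`.
  have hnear : ∀ᶠ y in 𝓝 u, g y = y := by
    have h1 : Tendsto (fun y => g^[4 * N] y - y) (𝓝 u) (𝓝 0) := by
      have : Continuous fun y => g^[4 * N] y - y := (hgc.iterate (4 * N)).sub continuous_id
      simpa [Function.iterate_fixed hgu] using this.tendsto u
    filter_upwards [h1.eventually (Ioo_mem_nhds (by norm_num : (-1 : ℝ) < 0) one_pos)] with y hy
    have h2 : g^[4 * N] y = y := by
      rcases lt_trichotomy y (g^[4 * N] y) with h | h | h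
      · linarith [hγ.one_le_sub h (hgK y).symm, hy.2]
      · exact h.symm
      · linarith [hγ.one_le_sub h (hgK y), hy.1]
    have h3 := (Function.Commute.id_right (f := g)).iterate_pos_eq_iff_map_eq hgm.monotone
      strictMono_id (x := y) (n := 4 * N) (by omega)
    rw [Function.iterate_id] at h3
    exact h3.1 h2
  obtain ⟨i, j, c, hX, ⟨a, ha, hi⟩, d, hd, hj⟩ := hS.crossing_corner hγ hu hX
  obtain ⟨K, hK, hKy⟩ := hS.exists_affine_nhds hγ f.continuous hf (k := l) (x := f u) (by
    intro n hn
    rw [← Function.iterate_succ_apply, ← semiconj_iterate hf]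
    exact hW n hn)
  obtain ⟨T', hT', hRT'⟩ := exists_linear_iterate hT hR (3 * k)
  have hfixed : ∀ᶠ y in 𝓝 u, ∀ i, γ y ∈ S i → γ u ∈ S i →
      (T' ∘ₗ K ∘ₗ M i) (γ y - γ u) = γ y - γ u := by
    filter_upwards [hnear, (f.continuous.tendsto u).eventually hKy] with y hy hyK i hyi hui
    have h1 := hγg y
    have h2 := hγg u
    rw [hy, Function.comp_apply, semiconj_iterate hf, Function.iterate_succ_apply] at h1
    rw [hgu, Function.comp_apply, semiconj_iterate hf, Function.iterate_succ_apply] at h2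
    have h3 := hRT' (γ (f^[l] (f y))) (γ (f^[l] (f u)))
    rw [h1, h2, hyK, ← hf, ← hf, hS.map_sub i _ hyi _ hui] at h3
    exact h3.symm
  obtain ⟨x, hx, hxI⟩ := ((hfixed.filter_mono nhdsWithin_le_nhds).and
    (Ioo_mem_nhdsLT (max_lt ha (sub_one_lt u)))).exists
  obtain ⟨y, hy, hyI⟩ := ((hfixed.filter_mono nhdsWithin_le_nhds).and
    (Ioo_mem_nhdsGT (lt_min hd (lt_add_one u)))).exists
  have hxa := (max_lt_iff.1 hxI.1)
  have hyd := (lt_min_iff.1 hyI.2)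
  have hxi := hi x ⟨hxa.1.le, hxI.2.le⟩
  have hyj := hj y ⟨hyI.1.le, hyd.1.le⟩
  have hex : area e (γ x - γ u) ≠ 0 := fun h => by
    have := hγ.one_le_sub hxI.2 (hX.transversal _ (hγ.mem x) (Or.inl hxi) h)
    linarith [hxa.2]
  have hey : area e (γ y - γ u) ≠ 0 := fun h => by
    have := hγ.one_le_sub hyI.1 (hX.transversal _ (hγ.mem y) (Or.inr hyj) h).symm
    linarith [hyd.2]
  refine not_fixed_both_sides (L := T' ∘ₗ K ∘ₗ M i) (L' := T' ∘ₗ K ∘ₗ M j) (e := e) (c := c)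
    (fun v w => ?_) (fun v w => ?_) ?_ hX.ne_zero (fun v => ?_)
    (hx i hxi (hi u ⟨ha.le, le_rfl⟩)) (hy j hyj (hj u ⟨le_rfl, hd.le⟩)) hex hey
  · simp [hT', hK, hS.area_map]
  · simp [hT', hK, hS.area_map]
  · simp [hX.map_eq]
  · simp [hT', hK, hX.jump]

end SectorSystem

/-! ### Lifts of symmetries of a closed curve -/

lemma eq_of_continuous_of_forall_int {ψ : ℝ → ℝ} (hc : Continuous ψ) (hint : ∀ x, ∃ n : ℤ, ψ x = n)
    (x y : ℝ) : ψ x = ψ y := by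
  choose n hn using hint
  have hnc : Continuous n := by
    rw [Int.isClosedEmbedding_coe_real.isInducing.continuous_iff]
    exact hc.congr hn
  rw [hn, hn, PreconnectedSpace.constant inferInstance hnc]

/-- A symmetry of order four without fixed points of a simple closed curve has an increasing lift
to the line of parameters. -/
lemma IsClosedCurve.exists_lift {Γ : Set Plane} {γ : ℝ → Plane} (hγ : IsClosedCurve Γ γ)
    {R : Plane → Plane} (hR : Continuous R) (hmaps : ∀ z ∈ Γ, R z ∈ Γ) (hR4 : ∀ z, R^[4] z = z)
    (hfix : ∀ z ∈ Γ, R z ≠ z) :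
    ∃ ρ : ℝ → ℝ, StrictMono ρ ∧ Continuous ρ ∧ ∀ x, R (γ x) = γ (ρ x) := by
  have : Fact ((0 : ℝ) < 1) := ⟨one_pos⟩
  set G : AddCircle (1 : ℝ) → Plane := hγ.periodic.lift with hG
  have hGcoe : ∀ x : ℝ, G x = γ x := hγ.periodic.lift_coe
  have hGc : Continuous G := continuous_coinduced_dom.2 hγ.continuous
  have hGi : Function.Injective G := by
    intro x y
    induction x using QuotientAddGroup.induction_on with | _ x
    induction y using QuotientAddGroup.induction_on with | _ y
    intro h
    obtain ⟨n, rfl⟩ := hγ.injective x y h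
    have : (((n : ℤ) : ℝ) : AddCircle (1 : ℝ)) = 0 :=
      (AddCircle.coe_eq_zero_iff 1).2 ⟨n, by simp⟩
    change (x : AddCircle (1 : ℝ)) = ((x + n : ℝ) : AddCircle (1 : ℝ))
    rw [AddCircle.coe_add, this, add_zero]
  have hGe := hGc.isClosedEmbedding hGi
  have hGr : ∀ x, R (γ x) ∈ range G := fun x => by
    obtain ⟨y, hy⟩ := hγ.range_eq ▸ hmaps _ (hγ.mem x)
    exact ⟨y, (hGcoe y).trans hy⟩
  set e := hGe.isEmbedding.toHomeomorph with he
  let φ : C(ℝ, AddCircle (1 : ℝ)) := ⟨fun x => e.symm ⟨R (γ x), hGr x⟩,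
    e.symm.continuous.comp ((hR.comp hγ.continuous).subtype_mk _)⟩
  have hφ : ∀ x, G (φ x) = R (γ x) := fun x =>
    congrArg Subtype.val (e.apply_symm_apply ⟨R (γ x), hGr x⟩)
  obtain ⟨e₀, he₀⟩ := QuotientAddGroup.mk_surjective (φ 0)
  obtain ⟨ρ, ⟨-, hρ⟩, -⟩ :=
    (AddCircle.isCoveringMap_coe (1 : ℝ)).existsUnique_continuousMap_lifts φ 0 e₀ he₀
  have hlift : ∀ x, R (γ x) = γ (ρ x) := fun x => by
    rw [← hφ, ← hGcoe, ← congrFun hρ x]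
    rfl
  have h4 : ∀ x, ∃ n : ℤ, ρ^[4] x - x = n := fun x => by
    obtain ⟨n, hn⟩ := hγ.injective x (ρ^[4] x) (by rw [← semiconj_iterate hlift, hR4])
    exact ⟨n, by linarith⟩
  have hc4 : Continuous fun x => ρ^[4] x - x := (ρ.continuous.iterate 4).sub continuous_id
  -- The fourth iterate of the lift is a translation, which excludes lifts of degree zero.
  have hinj : Function.Injective ρ := by
    intro x y hxy
    have h1 := eq_of_continuous_of_forall_int hc4 h4 x y
    have h2 : ρ^[4] x = ρ^[4] y := by
      rw [Function.iterate_succ_apply, hxy, ← Function.iterate_succ_apply]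
    linarith
  refine ⟨ρ, ?_, ρ.continuous, hlift⟩
  -- A decreasing lift would have a fixed point.
  rcases ρ.continuous.strictMono_of_inj hinj with h | h
  · exact h
  · have h1 : min 0 (ρ 0) ≤ ρ (min 0 (ρ 0)) :=
      (min_le_right _ _).trans (h.antitone (min_le_left _ _))
    have h2 : ρ (max 0 (ρ 0)) ≤ max 0 (ρ 0) :=
      (h.antitone (le_max_left _ _)).trans (le_max_right _ _)
    obtain ⟨x, hx⟩ := intermediate_value_univ₂ continuous_id ρ.continuous h1 h2
    exact absurd (by rw [hlift, ← hx]; rfl) (hfix _ (hγ.mem x))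

/-! ### The eight outer pieces of the square -/

/-- The linear part of `rot`. -/
def rotLin : Plane →ₗ[ℝ] Plane where
  toFun v := (-v.2, v.1)
  map_add' v w := by ext <;> simp; ring
  map_smul' r v := by ext <;> simp

/-- The linear part of `rotInv`. -/
def rotInvLin : Plane →ₗ[ℝ] Plane where
  toFun v := (v.2, -v.1)
  map_add' v w := by ext <;> simp; ring
  map_smul' r v := by ext <;> simp

/-- The map `mapA θ` as a linear map. -/
noncomputable def linA (θ : ℝ) : Plane →ₗ[ℝ] Plane where
  toFun := mapA θ
  map_add' v w := by ext <;> simp [mapA]; ring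
  map_smul' r v := by ext <;> simp [mapA]; ring

/-- The map `mapB θ` as a linear map. -/
noncomputable def linB (θ : ℝ) : Plane →ₗ[ℝ] Plane where
  toFun := mapB θ
  map_add' v w := by ext <;> simp [mapB] <;> ring
  map_smul' r v := by ext <;> simp [mapB] <;> ring

/-- The eight outer pieces, `pieceA θ i` and `pieceB θ i`. -/
def sector (θ : ℝ) : Fin 4 ⊕ Fin 4 → Set Plane :=
  Sum.elim (pieceA θ) (pieceB θ)

/-- The linear part of `F θ` on an outer piece. -/
noncomputable def sectorLin (θ : ℝ) : Fin 4 ⊕ Fin 4 → Plane →ₗ[ℝ] Plane :=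
  Sum.elim (fun i => (rotLin ^ (i : ℕ)) ∘ₗ linA θ ∘ₗ (rotInvLin ^ (i : ℕ)))
    (fun i => (rotLin ^ (i : ℕ)) ∘ₗ linB θ ∘ₗ (rotInvLin ^ (i : ℕ)))

lemma rot_sub (z w : Plane) : rot z - rot w = rotLin (z - w) := by
  ext <;> simp [rot, rotLin]

lemma rot_iter_sub (n : ℕ) (z w : Plane) : rot^[n] z - rot^[n] w = (rotLin ^ n) (z - w) := by
  induction n with
  | zero => rfl
  | succ n ih =>
    rw [Function.iterate_succ_apply', Function.iterate_succ_apply', rot_sub, ih, pow_succ']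
    rfl

lemma rotInv_iter_sub (n : ℕ) (z w : Plane) :
    rotInv^[n] z - rotInv^[n] w = (rotInvLin ^ n) (z - w) := by
  induction n with
  | zero => rfl
  | succ n ih =>
    rw [Function.iterate_succ_apply', Function.iterate_succ_apply', pow_succ', Module.End.mul_apply,
      ← ih]
    ext <;> simp [rotInv, rotInvLin]

lemma conjRot_sub (i : Fin 4) (g : Plane →ₗ[ℝ] Plane) (z w : Plane) :
    conjRot i g z - conjRot i g w
      = ((rotLin ^ (i : ℕ)) ∘ₗ g ∘ₗ (rotInvLin ^ (i : ℕ))) (z - w) := by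
  rw [conjRot, conjRot, rot_iter_sub, ← map_sub, rotInv_iter_sub]
  rfl

lemma area_rotLin (v w : Plane) : area (rotLin v) (rotLin w) = area v w := by
  simp [area, rotLin]; ring

lemma area_rotLin_pow (n : ℕ) (v w : Plane) :
    area ((rotLin ^ n) v) ((rotLin ^ n) w) = area v w := by
  induction n with
  | zero => rfl
  | succ n ih => rw [pow_succ', Module.End.mul_apply, Module.End.mul_apply, area_rotLin, ih]

lemma area_rotInvLin_pow (n : ℕ) (v w : Plane) :
    area ((rotInvLin ^ n) v) ((rotInvLin ^ n) w) = area v w := by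
  induction n with
  | zero => rfl
  | succ n ih =>
    rw [pow_succ', Module.End.mul_apply, Module.End.mul_apply, ← ih]
    simp [area, rotInvLin]; ring

lemma area_linA (θ : ℝ) (v w : Plane) : area (linA θ v) (linA θ w) = area v w := by
  simp [area, linA, mapA]; ring

lemma area_linB {θ : ℝ} (hθ : θ ∈ Ioo 0 (Real.pi / 4)) (v w : Plane) :
    area (linB θ v) (linB θ w) = area v w := by
  obtain ⟨h1, h2, h3, h4⟩ := coords hθ
  have hts : tCoord θ - sCoord θ ≠ 0 := by linarith
  simp only [area, linB, mapB, LinearMap.coe_mk, AddHom.coe_mk]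
  generalize sCoord θ = s at *
  generalize tCoord θ = t at *
  rw [div_mul_div_comm, div_mul_div_comm, ← sub_div, div_eq_iff (mul_ne_zero hts hts)]
  linear_combination (v.1 * w.2 - v.2 * w.1) * (2 * t ^ 2 + t - 1) * h4

lemma rot_mem_A {θ : ℝ} {i : Fin 4} {z : Plane} (h : z ∈ pieceA θ i) :
    rot z ∈ pieceA θ (1 + i) := by
  rw [mem_A_iff, rotInv_iter_add]
  simpa using (mem_A_iff θ i z).1 h

lemma rot_mem_B {θ : ℝ} {i : Fin 4} {z : Plane} (h : z ∈ pieceB θ i) :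
    rot z ∈ pieceB θ (1 + i) := by
  rw [mem_B_iff, rotInv_iter_add]
  simpa using (mem_B_iff θ i z).1 h

lemma rot_mem_square {z : Plane} : rot z ∈ square ↔ z ∈ square := by
  simpa using (square_rotInv (n := 1) (z := rot z)).symm

lemma F_of_notMem_square {θ : ℝ} (hθ : θ ∈ Ioo 0 (Real.pi / 4)) {z : Plane} (hz : z ∉ square) :
    F θ z = z := by
  rw [mem_square_iff hθ] at hz
  push Not at hz
  rw [F, if_neg hz.1, dif_neg (by simpa using hz.2.1), dif_neg (by simpa using hz.2.2)]

lemma rot_commute_F {θ : ℝ} (hθ : θ ∈ Ioo 0 (Real.pi / 4)) : Function.Commute rot (F θ) := by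
  intro z
  by_cases hz : z ∈ square
  · rcases (mem_square_iff hθ z).1 hz with h | ⟨i, h⟩ | ⟨i, h⟩
    · rw [F_of_mem_C θ h, F_of_mem_C θ ((rot_mem_C hθ (rot z)).1 (by simpa)), mapC_rot]
    · rw [F_of_mem_A hθ h, F_of_mem_A hθ (rot_mem_A h), conjRot_add]
      simp
    · rw [F_of_mem_B hθ h, F_of_mem_B hθ (rot_mem_B h), conjRot_add]
      simp
  · rw [F_of_notMem_square hθ hz, F_of_notMem_square hθ (rot_mem_square.not.2 hz)]

lemma rot_iter_four (z : Plane) : rot^[4] z = z := by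
  simp [rot]

lemma continuous_rot : Continuous rot := by
  unfold rot; fun_prop

lemma eq_Z_of_rot_eq {z : Plane} (h : rot z = z) : z = Z := by
  obtain ⟨x, y⟩ := z
  simp only [rot, Prod.mk.injEq] at h
  ext <;> simp only [Z] <;> linarith [h.1, h.2]

lemma Z_mem_C {θ : ℝ} (hθ : θ ∈ Ioo 0 (Real.pi / 4)) : Z ∈ pieceC θ := by
  obtain ⟨h1, h2, h3, h4⟩ := coords hθ
  rw [mem_C hθ]
  simp only [Z]
  refine ⟨?_, ?_, ?_, ?_⟩ <;> linarith

/-! ### Intersections of the pieces -/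

lemma eq_E_of_mem_A_of_mem_A {θ : ℝ} (hθ : θ ∈ Ioo 0 (Real.pi / 4)) {i j : Fin 4} (hij : i ≠ j)
    {z : Plane} (hi : z ∈ pieceA θ i) (hj : z ∈ pieceA θ j) : ∃ k, z = E k := by
  obtain ⟨k, rfl⟩ : ∃ k, j = i + k := ⟨j - i, by abel⟩
  rw [mem_A_iff] at hi
  rw [mem_A_iff, rotInv_iter_add] at hj
  suffices h : rotInv^[(i : ℕ)] z = E 0 ∨ rotInv^[(i : ℕ)] z = E 1 by
    have hz := rot_iter_rotInv_iter i z
    rcases h with h | h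
    · exact ⟨i, by rw [← hz, h]; rfl⟩
    · refine ⟨i + 1, ?_⟩
      rw [← hz, h, ← rot_E, show E 1 = rot (E 0) from (rot_E 0).symm, ← Function.iterate_succ_apply,
        Function.iterate_succ_apply']
      rfl
  generalize rotInv^[(i : ℕ)] z = w at *
  rw [mem_A_zero hθ] at hi hj
  obtain ⟨h1, h2, h3, h4⟩ := coords hθ
  obtain ⟨x, y⟩ := w
  obtain ⟨a1, a2, a3⟩ := hi
  obtain ⟨c1, c2, c3⟩ := hj
  have hk : k ≠ 0 := by rintro rfl; simp at hij
  fin_cases k <;> simp [E, rot, rotInv] at *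
  all_goals
    generalize sCoord θ = s at *
    generalize tCoord θ = t at *
  · right
    have hy : y = 0 := by
      have : 0 ≤ y * (t - s) := by nlinarith
      nlinarith
    subst hy
    exact ⟨by nlinarith, rfl⟩
  · exfalso; nlinarith
  · left
    have hx : x = 0 := by
      have : 0 ≤ x * (t - s) := by nlinarith
      nlinarith
    subst hx
    exact ⟨rfl, by nlinarith⟩

lemma mem_C_of_mem_B_of_mem_B {θ : ℝ} (hθ : θ ∈ Ioo 0 (Real.pi / 4)) {i j : Fin 4} (hij : i ≠ j)
    {z : Plane} (hi : z ∈ pieceB θ i) (hj : z ∈ pieceB θ j) : z ∈ pieceC θ := by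
  obtain ⟨k, rfl⟩ : ∃ k, j = i + k := ⟨j - i, by abel⟩
  rw [mem_B_iff] at hi
  rw [mem_B_iff, rotInv_iter_add] at hj
  rw [← rotInv_iter_mem_C hθ i, mem_C hθ]
  generalize rotInv^[(i : ℕ)] z = w at *
  rw [mem_B_zero hθ] at hi hj
  obtain ⟨h1, h2, h3, h4⟩ := coords hθ
  obtain ⟨x, y⟩ := w
  obtain ⟨a1, a2, a3⟩ := hi
  obtain ⟨c1, c2, c3⟩ := hj
  have hk : k ≠ 0 := by rintro rfl; simp at hij
  fin_cases k <;> simp [rotInv] at *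
  all_goals
    generalize sCoord θ = s at *
    generalize tCoord θ = t at *
  · have hx : t * x = s * y := by linarith
    have hy : y = t := by
      have : t * (t - y) = t * (t * (1 - y) - s * x) + s * (t * x - s * y) + y * (s ^ 2 - t + t ^ 2)
        := by ring
      nlinarith
    obtain rfl : t = y := hy.symm
    obtain rfl : s = x := mul_left_cancel₀ h1.ne' (by linarith)
    refine ⟨?_, ?_, ?_, ?_⟩ <;> nlinarith
  · exfalso; nlinarith
  · have hx : t * (1 - y) = s * x := by linarith
    have hy : x = t := by
      have : t * (t - x) = t * (t * (1 - x) - s * (1 - y)) + s * (t * (1 - y) - s * x)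
        + x * (s ^ 2 - t + t ^ 2) := by ring
      nlinarith
    obtain rfl : t = x := hy.symm
    obtain rfl : y = 1 - s := mul_left_cancel₀ h1.ne' (by linarith)
    refine ⟨?_, ?_, ?_, ?_⟩ <;> nlinarith

lemma eq_or_eq_of_mem_A_of_mem_B {θ : ℝ} (hθ : θ ∈ Ioo 0 (Real.pi / 4)) {i j : Fin 4}
    {z : Plane} (hi : z ∈ pieceA θ i) (hj : z ∈ pieceB θ j) : j = i ∨ j = i + 1 := by
  obtain ⟨k, rfl⟩ : ∃ k, j = i + k := ⟨j - i, by abel⟩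
  rw [mem_A_iff] at hi
  rw [mem_B_iff, rotInv_iter_add] at hj
  generalize rotInv^[(i : ℕ)] z = w at *
  rw [mem_A_zero hθ] at hi
  rw [mem_B_zero hθ] at hj
  obtain ⟨h1, h2, h3, h4⟩ := coords hθ
  obtain ⟨x, y⟩ := w
  obtain ⟨a1, a2, a3⟩ := hi
  obtain ⟨c1, c2, c3⟩ := hj
  fin_cases k <;> simp [rotInv] at *
  all_goals
    generalize sCoord θ = s at *
    generalize tCoord θ = t at *
    exfalso; nlinarith

lemma isClosed_sector (θ : ℝ) (i : Fin 4 ⊕ Fin 4) : IsClosed (sector θ i) := by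
  have h : ∀ a b c : Plane, IsClosed (convexHull ℝ ({a, b, c} : Set Plane)) := fun a b c =>
    (Set.toFinite {a, b, c}).isClosed_convexHull ℝ
  rcases i with i | i <;> exact h _ _ _

lemma F_sub {θ : ℝ} (hθ : θ ∈ Ioo 0 (Real.pi / 4)) (i : Fin 4 ⊕ Fin 4) {z w : Plane}
    (hz : z ∈ sector θ i) (hw : w ∈ sector θ i) : F θ z - F θ w = sectorLin θ i (z - w) := by
  rcases i with i | i
  · rw [F_of_mem_A hθ hz, F_of_mem_A hθ hw]
    exact conjRot_sub i (linA θ) z w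
  · rw [F_of_mem_B hθ hz, F_of_mem_B hθ hw]
    exact conjRot_sub i (linB θ) z w

lemma area_sectorLin {θ : ℝ} (hθ : θ ∈ Ioo 0 (Real.pi / 4)) (i : Fin 4 ⊕ Fin 4) (v w : Plane) :
    area (sectorLin θ i v) (sectorLin θ i w) = area v w := by
  rcases i with i | i <;>
    simp [sectorLin, area_rotLin_pow, area_rotInvLin_pow, area_linA, area_linB hθ]

/-! ### The break points of a symmetric curve -/

/-- The points `U i`, `V i` in which a rotationally symmetric curve in the square, disjoint from the
centre square, meets the break segments. -/
structure IsBreakPoints (θ : ℝ) (Γ : Set Plane) (U V : Fin 4 → Plane) : Prop where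
  subset_square : Γ ⊆ square
  symm : IsRotSymm Γ
  disj : Disjoint Γ (pieceC θ)
  inter_U : ∀ i, Γ ∩ (pieceB θ i ∩ pieceA θ i) = {U i}
  inter_V : ∀ i, Γ ∩ (pieceA θ i ∩ pieceB θ (i + 1)) = {V i}

namespace IsBreakPoints

variable {θ : ℝ} {Γ : Set Plane} {U V : Fin 4 → Plane}

lemma mem_U (h : IsBreakPoints θ Γ U V) (i : Fin 4) :
    U i ∈ Γ ∧ U i ∈ pieceB θ i ∧ U i ∈ pieceA θ i := by
  have : U i ∈ Γ ∩ (pieceB θ i ∩ pieceA θ i) := by rw [h.inter_U]; rfl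
  exact this

lemma mem_V (h : IsBreakPoints θ Γ U V) (i : Fin 4) :
    V i ∈ Γ ∧ V i ∈ pieceA θ i ∧ V i ∈ pieceB θ (i + 1) := by
  have : V i ∈ Γ ∩ (pieceA θ i ∩ pieceB θ (i + 1)) := by rw [h.inter_V]; rfl
  exact this

lemma eq_U (h : IsBreakPoints θ Γ U V) {i : Fin 4} {z : Plane} (hz : z ∈ Γ) (hB : z ∈ pieceB θ i)
    (hA : z ∈ pieceA θ i) : z = U i := by
  have : z ∈ Γ ∩ (pieceB θ i ∩ pieceA θ i) := ⟨hz, hB, hA⟩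
  rwa [h.inter_U] at this

lemma eq_V (h : IsBreakPoints θ Γ U V) {i : Fin 4} {z : Plane} (hz : z ∈ Γ) (hA : z ∈ pieceA θ i)
    (hB : z ∈ pieceB θ (i + 1)) : z = V i := by
  have : z ∈ Γ ∩ (pieceA θ i ∩ pieceB θ (i + 1)) := ⟨hz, hA, hB⟩
  rwa [h.inter_V] at this

lemma rot_mem (h : IsBreakPoints θ Γ U V) {z : Plane} (hz : z ∈ Γ) : rot z ∈ Γ :=
  h.symm ▸ mem_image_of_mem rot hz

lemma rot_U (h : IsBreakPoints θ Γ U V) (i : Fin 4) : rot (U i) = U (1 + i) := by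
  obtain ⟨h1, h2, h3⟩ := h.mem_U i
  exact h.eq_U (h.rot_mem h1) (rot_mem_B h2) (rot_mem_A h3)

lemma rot_V (h : IsBreakPoints θ Γ U V) (i : Fin 4) : rot (V i) = V (1 + i) := by
  obtain ⟨h1, h2, h3⟩ := h.mem_V i
  exact h.eq_V (h.rot_mem h1) (rot_mem_A h2) (by rw [add_assoc]; exact rot_mem_B h3)

lemma rot_iter_U (h : IsBreakPoints θ Γ U V) (k i : Fin 4) :
    rot^[(k : ℕ)] (U i) = U (k + i) := by
  fin_cases k <;> simp [h.rot_U, ← add_assoc]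

lemma rot_iter_V (h : IsBreakPoints θ Γ U V) (k i : Fin 4) :
    rot^[(k : ℕ)] (V i) = V (k + i) := by
  fin_cases k <;> simp [h.rot_V, ← add_assoc]

/-- Distinct pieces of type `B` meet in the centre square only, hence not on the curve. -/
lemma eq_of_mem_B (h : IsBreakPoints θ Γ U V) (hθ : θ ∈ Ioo 0 (Real.pi / 4)) {i j : Fin 4}
    {z : Plane} (hz : z ∈ Γ) (hi : z ∈ pieceB θ i) (hj : z ∈ pieceB θ j) : i = j := by
  by_contra hij
  exact disjoint_left.1 h.disj hz (mem_C_of_mem_B_of_mem_B hθ hij hi hj)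

lemma injective_U (h : IsBreakPoints θ Γ U V) (hθ : θ ∈ Ioo 0 (Real.pi / 4)) :
    Function.Injective U := fun i j hij =>
  h.eq_of_mem_B hθ (h.mem_U i).1 (h.mem_U i).2.1 (hij ▸ (h.mem_U j).2.1)

/-- A vertex of the square on the curve is a point `U i` as well as a point `V j`. -/
lemma E_notMem (h : IsBreakPoints θ Γ U V) (hUV : ∀ i j, U i ≠ V j) (i : Fin 4) : E i ∉ Γ := by
  obtain ⟨i, rfl⟩ : ∃ k, i = k + 1 := ⟨i - 1, by abel⟩
  intro hE
  refine hUV (i + 1) i ?_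
  rw [← h.eq_U hE (subset_convexHull ℝ _ (by simp)) (subset_convexHull ℝ _ (by simp)),
    ← h.eq_V hE (subset_convexHull ℝ _ (by simp)) (subset_convexHull ℝ _ (by simp))]

lemma eq_of_mem_A (h : IsBreakPoints θ Γ U V) (hθ : θ ∈ Ioo 0 (Real.pi / 4))
    (hUV : ∀ i j, U i ≠ V j) {i j : Fin 4} {z : Plane} (hz : z ∈ Γ) (hi : z ∈ pieceA θ i)
    (hj : z ∈ pieceA θ j) : i = j := by
  by_contra hij
  obtain ⟨k, rfl⟩ := eq_E_of_mem_A_of_mem_A hθ hij hi hj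
  exact h.E_notMem hUV k hz

/-- The outer pieces form a sector system for the curve, unless some `U i` equals some `V j`. -/
lemma sectorSystem (h : IsBreakPoints θ Γ U V) (hθ : θ ∈ Ioo 0 (Real.pi / 4))
    (hUV : ∀ i j, U i ≠ V j) :
    SectorSystem Γ (range U ∪ range V) (F θ) (sector θ) (sectorLin θ) where
  closed := isClosed_sector θ
  cover z hz := by
    rcases (mem_square_iff hθ z).1 (h.subset_square hz) with hC | ⟨i, hi⟩ | ⟨i, hi⟩
    · exact absurd hC (disjoint_left.1 h.disj hz)
    · exact ⟨Sum.inl i, hi⟩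
    · exact ⟨Sum.inr i, hi⟩
  map_sub i z hz w hw := F_sub hθ i hz hw
  area_map := area_sectorLin hθ
  inter := by
    have key : ∀ i j z, z ∈ Γ → z ∈ pieceA θ i → z ∈ pieceB θ j → z ∈ range U ∪ range V := by
      intro i j z hz hA hB
      rcases eq_or_eq_of_mem_A_of_mem_B hθ hA hB with rfl | rfl
      · exact Or.inl ⟨j, (h.eq_U hz hB hA).symm⟩
      · exact Or.inr ⟨i, (h.eq_V hz hA hB).symm⟩
    rintro (i | i) (j | j) hij z hz hi hj
    · exact absurd (congrArg Sum.inl (h.eq_of_mem_A hθ hUV hz hi hj)) hij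
    · exact key i j z hz hi hj
    · exact key j i z hz hj hi
    · exact absurd (congrArg Sum.inr (h.eq_of_mem_B hθ hz hi hj)) hij
  finite := (finite_range U).union (finite_range V)
  subset := by
    rintro z (⟨i, rfl⟩ | ⟨i, rfl⟩)
    · exact (h.mem_U i).1
    · exact (h.mem_V i).1
  two := by
    have key : ∀ (T : Set Plane) (a b : Plane), T ⊆ {a, b} → T.ncard ≤ 2 := by
      intro T a b hT
      have h1 := ncard_le_ncard hT
      have h2 := ncard_insert_le a {b}
      rw [ncard_singleton] at h2
      omega
    rintro (i | i)
    · refine key _ (U i) (V i) ?_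
      rintro z ⟨⟨j, rfl⟩ | ⟨j, rfl⟩, hz⟩
      · rw [h.eq_of_mem_A hθ hUV (h.mem_U j).1 (h.mem_U j).2.2 hz]; exact Or.inl rfl
      · rw [h.eq_of_mem_A hθ hUV (h.mem_V j).1 (h.mem_V j).2.1 hz]; exact Or.inr rfl
    · refine key _ (U i) (V (i - 1)) ?_
      rintro z ⟨⟨j, rfl⟩ | ⟨j, rfl⟩, hz⟩
      · rw [h.eq_of_mem_B hθ (h.mem_U j).1 (h.mem_U j).2.1 hz]; exact Or.inl rfl
      · rw [← h.eq_of_mem_B hθ (h.mem_V j).1 (h.mem_V j).2.2 hz, add_sub_cancel_right]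
        exact Or.inr rfl
  three := by
    have h01 : U 0 ≠ U 1 := (h.injective_U hθ).ne (by decide)
    have hsub : {U 0, U 1, V 0} ⊆ range U ∪ range V := by
      rintro z (rfl | rfl | rfl)
      · exact Or.inl ⟨0, rfl⟩
      · exact Or.inl ⟨1, rfl⟩
      · exact Or.inr ⟨0, rfl⟩
    have h1 := ncard_le_ncard hsub ((finite_range U).union (finite_range V))
    rw [ncard_eq_three.2 ⟨_, _, _, h01, hUV 0 0, hUV 1 0, rfl⟩] at h1
    omega

lemma isCorner_U (h : IsBreakPoints θ Γ U V) (hθ : θ ∈ Ioo 0 (Real.pi / 4))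
    (hUV : ∀ i j, U i ≠ V j) :
    IsCorner Γ (sector θ) (sectorLin θ) (U 0) (Sum.inl 0) (Sum.inr 0) (P θ 0)
      ((1 - 2 * sCoord θ) / (tCoord θ * (sCoord θ - tCoord θ))) := by
  obtain ⟨h1, h2, h3, h4⟩ := coords hθ
  have hts : tCoord θ - sCoord θ ≠ 0 := by linarith
  have hst : sCoord θ - tCoord θ ≠ 0 := by linarith
  have hs : 1 - 2 * sCoord θ ≠ 0 := by linarith
  obtain ⟨hU, hUB, hUA⟩ := h.mem_U 0
  refine ⟨?_, ?_, by positivity, fun v => ?_, fun z hz hzS hze => ?_⟩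
  · rintro (k | k) hk
    · exact Or.inl (congrArg Sum.inl (h.eq_of_mem_A hθ hUV hU hk hUA))
    · exact Or.inr (congrArg Sum.inr (h.eq_of_mem_B hθ hU hk hUB))
  · have hP : P θ 0 ∈ pieceA θ 0 ∧ P θ 0 ∈ pieceB θ 0 :=
      ⟨subset_convexHull ℝ _ (by simp), subset_convexHull ℝ _ (by simp)⟩
    have := agree_AB hθ 0 (P θ 0) hP.1 hP.2
    exact this
  · simp only [sectorLin, Sum.elim_inl, Sum.elim_inr, Fin.val_zero, pow_zero, Module.End.one_eq_id,
      LinearMap.id_comp, LinearMap.comp_id, linA, linB, LinearMap.coe_mk, AddHom.coe_mk, mapA, mapB,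
      area, P, Function.iterate_zero, id]
    generalize sCoord θ = s at *
    generalize tCoord θ = t at *
    have ht := h1.ne'
    have hst' : s - t = -(t - s) := by ring
    rw [hst']
    field_simp
    linear_combination ((1 - 2 * s) * v.2 ^ 2 + t * v.1 * v.2) * h4
  · rw [mem_A_zero hθ] at hUA
    rw [mem_B_zero hθ] at hUB
    suffices hz' : z ∈ pieceA θ 0 ∧ z ∈ pieceB θ 0 from h.eq_U hz hz'.2 hz'.1
    simp only [area, P, Fin.val_zero, Function.iterate_zero, id, Prod.fst_sub, Prod.snd_sub] at hze
    change z ∈ pieceA θ 0 ∨ z ∈ pieceB θ 0 at hzS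
    rw [mem_A_zero hθ, mem_B_zero hθ] at hzS ⊢
    generalize sCoord θ = s at *
    generalize tCoord θ = t at *
    have hline : t * z.1 = s * z.2 := by linarith [hUA.2.1, hUB.1]
    obtain ⟨l, hl⟩ : ∃ l, z.2 = t * l := ⟨z.2 / t, by field_simp⟩
    have hl' : z.1 = s * l := mul_left_cancel₀ h1.ne' (by rw [hline, hl]; ring)
    rw [hl, hl'] at hzS ⊢
    have e1 : (1 - s) * (s * l) - t * (t * l) = (s - t) * l := by linear_combination -l * h4
    have e2 : t * (1 - t * l) - s * (s * l) = t * (1 - l) := by linear_combination -l * h4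
    have e3 : t * (1 - s * l) - (1 - s) * (t * l) = t * (1 - l) := by ring
    have e4 : t * (s * l) - s * (t * l) = 0 := by ring
    rw [e1, e2, e3, e4] at hzS ⊢
    have hl01 : 0 ≤ l ∧ 0 ≤ 1 - l := by
      rcases hzS with ⟨a1, -, a3⟩ | ⟨-, a2, a3⟩
      · exact ⟨nonneg_of_mul_nonneg_right a1 h1, nonneg_of_mul_nonneg_right a3 h1⟩
      · exact ⟨nonneg_of_mul_nonneg_right a2 (by linarith), nonneg_of_mul_nonneg_right a3 h1⟩
    have f1 := mul_nonneg h1.le hl01.1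
    have f2 := mul_nonneg h1.le hl01.2
    have f3 := mul_nonneg (sub_nonneg.2 h2.le) hl01.1
    exact ⟨⟨f1, le_rfl, f2⟩, le_rfl, f3, f2⟩

lemma isCorner_V (h : IsBreakPoints θ Γ U V) (hθ : θ ∈ Ioo 0 (Real.pi / 4))
    (hUV : ∀ i j, U i ≠ V j) :
    IsCorner Γ (sector θ) (sectorLin θ) (V 0) (Sum.inl 0) (Sum.inr 1) (P θ 0 - E 1)
      ((1 - 2 * sCoord θ) / (tCoord θ * (sCoord θ - tCoord θ))) := by
  obtain ⟨h1, h2, h3, h4⟩ := coords hθ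
  have hts : tCoord θ - sCoord θ ≠ 0 := by linarith
  have hst : sCoord θ - tCoord θ ≠ 0 := by linarith
  have hs : 1 - 2 * sCoord θ ≠ 0 := by linarith
  obtain ⟨hV, hVA, hVB⟩ := h.mem_V 0
  rw [zero_add] at hVB
  refine ⟨?_, ?_, by positivity, fun v => ?_, fun z hz hzS hze => ?_⟩
  · rintro (k | k) hk
    · exact Or.inl (congrArg Sum.inl (h.eq_of_mem_A hθ hUV hV hk hVA))
    · exact Or.inr (congrArg Sum.inr (h.eq_of_mem_B hθ hV hk hVB))
  · have hA : E 1 ∈ sector θ (Sum.inl 0) ∧ P θ 0 ∈ sector θ (Sum.inl 0) :=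
      ⟨subset_convexHull ℝ _ (by simp), subset_convexHull ℝ _ (by simp)⟩
    have hB : E 1 ∈ sector θ (Sum.inr 1) ∧ P θ 0 ∈ sector θ (Sum.inr 1) :=
      ⟨subset_convexHull ℝ _ (by simp), subset_convexHull ℝ _ (by simp)⟩
    rw [← F_sub hθ _ hA.2 hA.1, ← F_sub hθ _ hB.2 hB.1]
  · simp only [sectorLin, Sum.elim_inl, Sum.elim_inr, Fin.val_zero, pow_zero, Module.End.one_eq_id,
      LinearMap.id_comp, LinearMap.comp_id, linA, linB, LinearMap.coe_mk, AddHom.coe_mk, mapA, mapB,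
      area, P, E, Function.iterate_zero, id, Fin.val_one, pow_one, LinearMap.comp_apply, rotLin,
      rotInvLin, Function.iterate_one, rot, Prod.fst_sub, Prod.snd_sub]
    generalize sCoord θ = s at *
    generalize tCoord θ = t at *
    have ht := h1.ne'
    have hst' : s - t = -(t - s) := by ring
    rw [hst']
    field_simp
    linear_combination -t * v.1 * v.2 * h4
  · rw [mem_A_zero hθ] at hVA
    rw [mem_B_iff, mem_B_zero hθ] at hVB
    suffices hz' : z ∈ pieceA θ 0 ∧ z ∈ pieceB θ 1 from h.eq_V hz hz'.1 hz'.2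
    simp only [area, P, E, Fin.val_zero, Function.iterate_zero, id, Prod.fst_sub, Prod.snd_sub,
      Fin.val_one, Function.iterate_one, rot] at hze
    change z ∈ pieceA θ 0 ∨ z ∈ pieceB θ 1 at hzS
    rw [mem_A_zero hθ, mem_B_iff, mem_B_zero hθ] at hzS ⊢
    simp only [Fin.val_one, Function.iterate_one, rotInv] at *
    generalize sCoord θ = s at *
    generalize tCoord θ = t at *
    have hline : t * (1 - z.1) = (1 - s) * z.2 := by linarith [hVA.2.2, hVB.2.1]
    obtain ⟨l, hl⟩ : ∃ l, z.2 = t * l := ⟨z.2 / t, by field_simp⟩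
    have hl' : z.1 = 1 - (1 - s) * l := mul_left_cancel₀ h1.ne' (by
      rw [hl] at hline; linear_combination -hline)
    rw [hl, hl'] at hzS ⊢
    have e1 : t * (t * l) - s * (1 - (1 - (1 - s) * l)) = -((s - t) * l) := by
      linear_combination l * h4
    have e2 : (1 - s) * (t * l) - t * (1 - (1 - (1 - s) * l)) = 0 := by ring
    have e3 : t * (1 - (1 - (1 - (1 - s) * l))) - s * (t * l) = t * (1 - l) := by ring
    have e4 : t * (1 - (1 - s) * l) - s * (t * l) = t * (1 - l) := by ring
    have e5 : t * (1 - (1 - (1 - s) * l)) - (1 - s) * (t * l) = 0 := by ring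
    rw [e1, e2, e3, e4, e5] at hzS ⊢
    have hl01 : 0 ≤ l ∧ 0 ≤ 1 - l := by
      rcases hzS with ⟨a1, a2, -⟩ | ⟨a1, -, a3⟩
      · exact ⟨nonneg_of_mul_nonneg_right a1 h1, nonneg_of_mul_nonneg_right a2 h1⟩
      · exact ⟨nonneg_of_mul_nonneg_right (neg_nonpos.1 a1) (by linarith),
          nonneg_of_mul_nonneg_right a3 h1⟩
    have f1 := mul_nonneg h1.le hl01.1
    have f2 := mul_nonneg h1.le hl01.2
    have f3 := mul_nonneg (sub_nonneg.2 h2.le) hl01.1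
    exact ⟨⟨f1, f2, le_rfl⟩, neg_nonpos.2 f3, le_rfl, f2⟩

end IsBreakPoints

/-! ### The orbits of the break points -/

/-- The rotation by `π/2` as a bijection of the plane. -/
def rotPerm : Equiv.Perm Plane where
  toFun := rot
  invFun := rotInv
  left_inv := rotInv_rot
  right_inv := rot_rotInv

lemma zpow_rot {θ : ℝ} (hθ : θ ∈ Ioo 0 (Real.pi / 4)) (m : ℤ) (n : ℕ) (z : Plane) :
    (FPerm θ hθ ^ m) (rot^[n] z) = rot^[n] ((FPerm θ hθ ^ m) z) := by
  have h : Commute rotPerm (FPerm θ hθ) := Equiv.ext (rot_commute_F hθ)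
  have h1 : Function.Commute rot (FPerm θ hθ ^ m : Equiv.Perm Plane) := fun z =>
    congrArg (fun P : Equiv.Perm Plane => P z) (h.zpow_right m).eq
  exact ((h1.iterate_left n) z).symm

lemma pow_apply_eq_iterate {θ : ℝ} (hθ : θ ∈ Ioo 0 (Real.pi / 4)) (k : ℕ) (z : Plane) :
    (FPerm θ hθ ^ (k : ℤ)) z = (F θ)^[k] z := by
  rw [zpow_natCast, ← Equiv.Perm.iterate_eq_pow]
  rfl

lemma zpow_four_mul_eq_self {θ : ℝ} (hθ : θ ∈ Ioo 0 (Real.pi / 4)) {m : ℤ} {n : ℕ} {z : Plane}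
    (h : (FPerm θ hθ ^ m) z = rot^[n] z) : (FPerm θ hθ ^ (4 * m)) z = z := by
  rw [show 4 * m = m + (m + (m + m)) by ring, zpow_add, zpow_add, zpow_add]
  simp only [Equiv.Perm.mul_apply, h, zpow_rot hθ]
  rw [← Function.iterate_add_apply, ← Function.iterate_add_apply, ← Function.iterate_add_apply,
    show n + n + n + n = 4 * n by ring, Function.iterate_mul]
  exact Function.iterate_fixed (rot_iter_four z) n

lemma iterate_natAbs_eq_self {θ : ℝ} (hθ : θ ∈ Ioo 0 (Real.pi / 4)) {m : ℤ} {z : Plane}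
    (h : (FPerm θ hθ ^ m) z = z) : (F θ)^[m.natAbs] z = z := by
  rw [← pow_apply_eq_iterate hθ]
  rcases Int.natAbs_eq m with h' | h'
  · rwa [← h']
  · rw [show ((m.natAbs : ℕ) : ℤ) = -m by omega, zpow_neg, Equiv.Perm.inv_eq_iff_eq, h]

/-- If a bijection shifts two families cyclically and some power takes one family to the other, then
between two visits of an orbit to the first family there is a visit to the second one. -/
lemma exists_visit_between {α : Type*} {P : Equiv.Perm α} {U V : Fin 4 → α} {X : α}
    (hU : ∀ (m : ℤ) (a b c : Fin 4), (P ^ m) (U a) = U b → (P ^ m) (U (c + a)) = U (c + b))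
    {m₀ : ℤ} {d : Fin 4} (hUV : ∀ i, (P ^ m₀) (U i) = V (i + d)) {m n : ℤ} (hmn : m < n)
    (hm : (P ^ m) X ∈ range U) (hn : (P ^ n) X ∈ range U) :
    ∃ k, m ≤ k ∧ k < n ∧ (P ^ k) X ∈ range V := by
  obtain ⟨i, hi⟩ := hm
  obtain ⟨j, hj⟩ := hn
  have hN : (P ^ (n - m)) (U i) = U j := by
    rw [hi, hj, ← Equiv.Perm.mul_apply, ← zpow_add, sub_add_cancel]
  have hN' : ∀ c, (P ^ (n - m)) (U c) = U (c - i + j) := fun c => by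
    have := hU _ _ _ (c - i) hN
    rwa [sub_add_cancel] at this
  have hmul : ∀ t : ℤ, ∀ c, (P ^ ((n - m) * t)) (U c) ∈ range U := by
    intro t
    induction t using Int.induction_on with
    | zero => intro c; simp
    | succ t ih =>
      intro c
      rw [mul_add, mul_one, zpow_add, Equiv.Perm.mul_apply, hN']
      exact ih _
    | pred t ih =>
      intro c
      have h1 : (P ^ (-(n - m))) (U c) = U (c - j + i) := by
        rw [zpow_neg, Equiv.Perm.inv_eq_iff_eq, hN', add_sub_cancel_right, sub_add_cancel]
      rw [show (n - m) * (-(t : ℤ) - 1) = (n - m) * -(t : ℤ) + -(n - m) by ring, zpow_add,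
        Equiv.Perm.mul_apply, h1]
      exact ih _
  have hpos : 0 < n - m := sub_pos.2 hmn
  -- The time `m + m₀` is moved into the given interval by a multiple of `n - m`.
  refine ⟨m₀ % (n - m) + m, ?_, ?_, ?_⟩
  · linarith [Int.emod_nonneg m₀ hpos.ne']
  · linarith [Int.emod_lt_of_pos m₀ hpos]
  · obtain ⟨c, hc⟩ := hmul (-(m₀ / (n - m))) i
    have h1 : m₀ % (n - m) = m₀ + (n - m) * -(m₀ / (n - m)) := by
      linarith [Int.emod_add_mul_ediv m₀ (n - m)]
    rw [zpow_add, Equiv.Perm.mul_apply, ← hi, h1, zpow_add, Equiv.Perm.mul_apply, ← hc, hUV]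
    exact ⟨_, rfl⟩

lemma IsParam.isClosedCurve {Γ : Set Plane} {γ : ℝ → Plane} (hγ : IsParam Γ γ) :
    IsClosedCurve Γ γ :=
  ⟨hγ.continuous, hγ.periodic, hγ.injective, hγ.range_eq⟩

/-- A lift of the homeomorphism `F θ` of an invariant curve is an automorphism of the line. -/
lemma IsLift.exists_orderIso {θ : ℝ} (hθ : θ ∈ Ioo 0 (Real.pi / 4)) {Γ : Set Plane}
    (himage : F θ '' Γ = Γ) {γ : ℝ → Plane} (hγ : IsClosedCurve Γ γ) {f : CircleDeg1Lift}
    (hf : IsLift θ γ f) : ∃ g : ℝ ≃o ℝ, ∀ x, g x = f x := by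
  have hinj : Function.Injective f := by
    intro x y hxy
    obtain ⟨n, rfl⟩ := hγ.injective x y ((FPerm θ hθ).injective (by
      change F θ (γ x) = F θ (γ y)
      rw [hf, hf, hxy]))
    rw [f.map_add_int] at hxy
    linarith
  have hsurj : Function.Surjective f := by
    intro y
    obtain ⟨z, hz, hzy⟩ := himage.symm ▸ hγ.mem y
    obtain ⟨x, rfl⟩ := hγ.range_eq ▸ hz
    rw [hf] at hzy
    obtain ⟨n, rfl⟩ := hγ.injective _ _ hzy
    exact ⟨x + n, f.map_add_int x n⟩
  exact ⟨StrictMono.orderIsoOfSurjective f (f.strictMono_iff_injective.2 hinj) hsurj, fun _ => rfl⟩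

namespace IsBreakPoints

variable {θ : ℝ} {Γ : Set Plane} {U V : Fin 4 → Plane}

/-- Some orbit contains a point `U i` as well as a point `V j`. -/
theorem exists_zpow_eq (h : IsBreakPoints θ Γ U V) (hθ : θ ∈ Ioo 0 (Real.pi / 4))
    (himage : F θ '' Γ = Γ) {p : ℤ} {q : ℕ} (hq : 0 < q)
    (hrot : HasRotationNumber θ Γ ((p : ℝ) / (q : ℝ))) :
    ∃ (m : ℤ) (i j : Fin 4), (FPerm θ hθ ^ m) (U i) = V j := by
  by_contra! hno
  have hUV : ∀ i j, U i ≠ V j := fun i j => by simpa using hno 0 i j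
  have hS := h.sectorSystem hθ hUV
  obtain ⟨γ, f₀, hγ₀, hf₀, n, hn⟩ := hrot
  have hγ := hγ₀.isClosedCurve
  obtain ⟨f, hf⟩ := hf₀.exists_orderIso hθ himage hγ
  have hff₀ : (f : ℝ → ℝ) = f₀ := funext hf
  have hlift : ∀ x, F θ (γ x) = γ (f x) := fun x => by rw [hf₀, hf]
  have hf1 : ∀ x, f (x + 1) = f x + 1 := fun x => by rw [hf, hf, f₀.map_add_one]
  obtain ⟨x₀, hx₀⟩ : ∃ x₀, f^[q] x₀ = x₀ + (p + q * n : ℤ) := by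
    have hq' : (q : ℝ) ≠ 0 := Nat.cast_ne_zero.2 hq.ne'
    have : f₀.translationNumber = ((p + q * n : ℤ) : ℝ) / q := by
      rw [hn]
      push_cast
      field_simp
    rw [f₀.translationNumber_eq_rat_iff (hff₀ ▸ f.continuous) hq] at this
    rw [hff₀, ← f₀.coe_pow]
    exact this
  -- The orbits of `U 0` and of `V 0` return to the break points.
  have hreturn : ∀ {X e : Plane} {i j : Fin 4 ⊕ Fin 4} {c : ℝ}, X ∈ range U ∪ range V →
      IsCorner Γ (sector θ) (sectorLin θ) X i j e c →
      ∃ k : ℤ, k ≠ 0 ∧ (FPerm θ hθ ^ k) X ∈ range U ∪ range V := by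
    intro X e i j c hX hc
    obtain ⟨u, -, rfl⟩ := hγ.exists_mem_Ico (hS.subset hX) 0
    obtain ⟨k, hk, hkW | hkW⟩ := hS.exists_return hγ hlift hf1 hq hx₀ hX hc
    · refine ⟨k, by omega, ?_⟩
      rwa [pow_apply_eq_iterate, semiconj_iterate hlift]
    · refine ⟨-k, by omega, ?_⟩
      have : (FPerm θ hθ ^ (k : ℤ)) (γ (f.symm^[k] u)) = γ u := by
        rw [pow_apply_eq_iterate, semiconj_iterate hlift,
          Function.LeftInverse.iterate f.apply_symm_apply k]
      rwa [zpow_neg, Equiv.Perm.inv_eq_iff_eq.2 this.symm]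
  obtain ⟨a, ha0, ha⟩ : ∃ a, 0 < a ∧ (F θ)^[a] (U 0) = U 0 := by
    obtain ⟨k, hk, ⟨i, hi⟩ | ⟨i, hi⟩⟩ := hreturn (Or.inl ⟨0, rfl⟩) (h.isCorner_U hθ hUV)
    · have := h.rot_iter_U i 0
      rw [add_zero, hi] at this
      exact ⟨_, by omega, iterate_natAbs_eq_self hθ (zpow_four_mul_eq_self hθ this.symm)⟩
    · exact absurd hi.symm (hno k 0 i)
  obtain ⟨b, hb0, hb⟩ : ∃ b, 0 < b ∧ (F θ)^[b] (V 0) = V 0 := by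
    obtain ⟨k, hk, ⟨i, hi⟩ | ⟨i, hi⟩⟩ := hreturn (Or.inr ⟨0, rfl⟩) (h.isCorner_V hθ hUV)
    · exact absurd (by rw [zpow_neg, Equiv.Perm.inv_eq_iff_eq, hi]) (hno (-k) i 0)
    · have := h.rot_iter_V i 0
      rw [add_zero, hi] at this
      exact ⟨_, by omega, iterate_natAbs_eq_self hθ (zpow_four_mul_eq_self hθ this.symm)⟩
  have hN : ∀ w ∈ range U ∪ range V, (F θ)^[a * b] w = w := by
    have hcomm : ∀ i : ℕ, ∀ z, (F θ)^[a * b] (rot^[i] z) = rot^[i] ((F θ)^[a * b] z) := fun i z =>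
      (((rot_commute_F hθ).iterate_iterate i (a * b)) z).symm
    rintro w (⟨i, rfl⟩ | ⟨i, rfl⟩)
    · rw [← add_zero i, ← h.rot_iter_U, hcomm, Function.iterate_mul, Function.iterate_fixed ha]
    · rw [← add_zero i, ← h.rot_iter_V, hcomm, mul_comm, Function.iterate_mul,
        Function.iterate_fixed hb]
  have hex : ∃ l, (F θ)^[l + 1] (U 0) ∈ range U :=
    ⟨a - 1, by rw [Nat.sub_add_cancel ha0, ha]; exact ⟨0, rfl⟩⟩
  classical
  obtain ⟨k, hk⟩ := Nat.find_spec hex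
  obtain ⟨u, -, hu⟩ := hγ.exists_mem_Ico (h.mem_U 0).1 0
  obtain ⟨ρ, hρm, hρc, hρ⟩ := hγ.exists_lift continuous_rot (fun z hz => h.rot_mem hz)
    rot_iter_four fun z hz hzZ =>
      disjoint_left.1 h.disj hz (by rw [eq_Z_of_rot_eq hzZ]; exact Z_mem_C hθ)
  refine hS.not_return_symm hγ hlift hf1 (Nat.mul_pos ha0 hb0) hN area_rotLin rot_sub rot_iter_four
    (rot_commute_F hθ) hρm hρc hρ (u := u) (l := Nat.find hex) (k := k)
    (by rw [hu]; exact Or.inl ⟨0, rfl⟩) (by rw [hu]; exact h.isCorner_U hθ hUV) ?_ ?_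
  · rw [hu, ← hk, h.rot_iter_U, add_zero]
  · rintro m hm (hmU | ⟨j, hj⟩)
    · rw [hu] at hmU
      exact Nat.find_min hex hm hmU
    · rw [hu, ← pow_apply_eq_iterate hθ] at hj
      exact hno _ _ _ hj.symm

end IsBreakPoints

end NinePiece

open NinePiece
theorem proposition4p4 (θ : ℝ) (hθ : θ ∈ Set.Ioo 0 (Real.pi / 4))
    (Γ : Set Plane) (hΓ : IsInvariantCircle θ Γ) (hsymm : IsRotSymm Γ)
    (hdisj : Disjoint Γ (pieceC θ))
    (p : ℤ) (q : ℕ) (hq : 0 < q) (hrot : HasRotationNumber θ Γ ((p : ℝ) / (q : ℝ)))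
    (U V : Fin 4 → Plane)
    (hU : ∀ i, Γ ∩ (pieceB θ i ∩ pieceA θ i) = {U i})
    (hV : ∀ i, Γ ∩ (pieceA θ i ∩ pieceB θ (i + 1)) = {V i}) :
    (∀ i, ∃ j, V j ∈ orbit θ hθ (U i)) ∧
    (∀ j, ∃ i, U i ∈ orbit θ hθ (V j)) ∧
    ∀ X, X ∈ Set.range U ∪ Set.range V →
      ∃ n : ℕ, {i | U i ∈ orbit θ hθ X}.ncard = n ∧ {j | V j ∈ orbit θ hθ X}.ncard = n ∧
        VisitsAlternate θ hθ X (Set.range U) (Set.range V) ∧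
        (2 ≤ n → ∃ k : ℕ, 0 < k ∧ (F θ)^[k] X = X) := by
  have h : IsBreakPoints θ Γ U V := ⟨hΓ.subset_square, hsymm, hdisj, hU, hV⟩
  obtain ⟨m₀, a, b, hab⟩ := h.exists_zpow_eq hθ hΓ.image_eq hq hrot
  -- By symmetry one power of the map takes every `U i` to some `V j`.
  have hUV : ∀ i, (FPerm θ hθ ^ m₀) (U i) = V (i + (b - a)) := fun i => by
    rw [← sub_add_cancel i a, ← h.rot_iter_U, zpow_rot, hab, h.rot_iter_V]
    congr 1
    abel
  have hVU : ∀ j, (FPerm θ hθ ^ (-m₀)) (V j) = U (j + (a - b)) := fun j => by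
    rw [zpow_neg, Equiv.Perm.inv_eq_iff_eq, hUV]
    congr 1
    abel
  have hshiftU : ∀ (m : ℤ) (i j c : Fin 4), (FPerm θ hθ ^ m) (U i) = U j →
      (FPerm θ hθ ^ m) (U (c + i)) = U (c + j) := fun m i j c e => by
    rw [← h.rot_iter_U, zpow_rot, e, h.rot_iter_U]
  have hshiftV : ∀ (m : ℤ) (i j c : Fin 4), (FPerm θ hθ ^ m) (V i) = V j →
      (FPerm θ hθ ^ m) (V (c + i)) = V (c + j) := fun m i j c e => by
    rw [← h.rot_iter_V, zpow_rot, e, h.rot_iter_V]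
  refine ⟨fun i => ⟨_, m₀, hUV i⟩, fun j => ⟨_, -m₀, hVU j⟩, fun X _ => ⟨_, rfl, ?_, ?_, ?_⟩⟩
  · have himage : {j | V j ∈ orbit θ hθ X} = (· + (b - a)) '' {i | U i ∈ orbit θ hθ X} := by
      ext j
      constructor
      · rintro ⟨m, hm⟩
        refine ⟨j + (a - b), ⟨-m₀ + m, ?_⟩, by simp only; abel⟩
        rw [zpow_add, Equiv.Perm.mul_apply, hm, hVU]
      · rintro ⟨i, ⟨m, hm⟩, rfl⟩
        refine ⟨m₀ + m, ?_⟩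
        rw [zpow_add, Equiv.Perm.mul_apply, hm, hUV]
    rw [himage, ncard_image_of_injective _ (add_left_injective _)]
  · exact fun m n hmn => ⟨exists_visit_between hshiftU hUV hmn, exists_visit_between hshiftV hVU hmn⟩
  · intro hn
    obtain ⟨i, ⟨m, hm⟩, j, ⟨m', hm'⟩, hij⟩ := (one_lt_ncard (Set.toFinite _)).1 hn
    have hne : m' - m ≠ 0 := by
      intro e
      obtain rfl : m' = m := sub_eq_zero.1 e
      exact hij (h.injective_U hθ (hm.symm.trans hm'))
    have e1 : (FPerm θ hθ ^ (m' - m)) (U i) = rot^[((j - i : Fin 4) : ℕ)] (U i) := by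
      rw [h.rot_iter_U, sub_add_cancel, ← hm, ← Equiv.Perm.mul_apply, ← zpow_add, sub_add_cancel,
        hm']
    have e2 : (FPerm θ hθ ^ (4 * (m' - m))) X = X := by
      have e3 := zpow_four_mul_eq_self hθ e1
      rw [← hm, ← Equiv.Perm.mul_apply, (Commute.zpow_zpow_self _ _ _).eq, Equiv.Perm.mul_apply] at e3
      exact (FPerm θ hθ ^ m).injective e3
    exact ⟨_, by omega, iterate_natAbs_eq_self hθ e2⟩
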